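/- **Setting.** The servers are the elements of a finite set $V$; each file $f$ of a finite set $F$ is stored on two distinct servers, so that the servers and files form a loopless multigraph with vertex set $V$ and edge set $F$. For a simple graph $G=(V,E)$ there is one file for each edge; for its $r$-multigraph $G^{(r)}$ there are $r$ files $(e,1),\dots,(e,r)$ for each edge $e\in E$, all stored on the two ends of $e$. A *PIR scheme* with files of $L\ge 1$ bits consists of independent uniform files $W_f\in\mathbb F_2^L$ and, for each desired file $\theta\in F$, a joint distribution of queries $(Q_v^{(\theta)})_{v\in V}$ (with finite alphabet) independent of the files; server $v$ returns an answer $A_v^{(\theta)}$ (from a finite alphabet) that is a function of $Q_v^{(\theta)}$ and of the family $\mathcal W_v$ of the files stored on $v$. It is required that $H(W_\theta\mid (A_v^{(\theta)},Q_v^{(\theta)})_{v\in V})=0$ for every $\theta$ (reliability), and that for every server $v$ the law of $(Q_v^{(\theta)},A_v^{(\theta)},\mathcal W_v)$ does not depend on $\theta$ (privacy). Its *rate* is $L/\sum_{v\in V}H(A_v^{(\theta)})$, which does not depend on $\theta$ (entropies in bits), and the *capacity* $\mathscr C$ is the supremum of the rates of all schemes over all $L$. A scheme *retrieves bits* if,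 for every $\theta$, every server $v$ storing $W_\theta$ and every query $q$ that $v$ receives with positive probability, there is a finite list $M$ of $\mathbb F_2$-linear combinations of the bits of $W_\theta$ such that, for any fixed contents of the other files on $v$, the answer of $v$ to $q$ and the list $M W_\theta$ determine each other. (For example, every scheme whose answers are $\mathbb F_2$-linear in the stored bits retrieves bits.) It satisfies the *symmetric retrieval property* (SRP) if, for every $\theta$, each of the two servers storing $W_\theta$ supplies half of its bits: $$H\bigl(A_v^{(\theta)}\,\big|\,Q_v^{(\theta)},\,\mathcal W_v\setminus\{W_\theta\}\bigr)=\frac L2\qquad\text{for both servers } v \text{ storing } W_\theta .$$ **Theorem 1.** Let $G$ be a finite simple graph with at least one edge, let $r\ge 1$, and let $T$ be a PIR scheme for $G$ that retrieves bits, satisfies the SRP and has rate $R(G)$. Then there is a PIR scheme $T^{(r)}$ for $G^{(r)}$ whose rate is at least $$R(G)\cdot\frac{1}{2-2^{1-r}} ,$$ and consequently $\mathscr C\bigl(G^{(r)}\bigr)\ge R(G)\cdot\dfrac{1}{2-2^{1-r}}$. -/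

import Mathlib

open scoped BigOperators

noncomputable section

/-! ### Shannon quantities on a finite probability space -/

namespace Shannon

variable {Ω α β : Type*} [Fintype Ω]

open Classical in
/-- `P(X = a)`, where `p ω` is the probability of the outcome `ω`. -/
def prob (p : Ω → ℝ) (X : Ω → α) (a : α) : ℝ :=
  ∑ ω, if X ω = a then p ω else 0

/-- The entropy `H(X)` in bits. -/
def entropy [Fintype α] (p : Ω → ℝ) (X : Ω → α) : ℝ :=
  -∑ a, prob p X a * Real.logb 2 (prob p X a)

/-- The conditional entropy `H(X | Y)` in bits. -/
def condEntropy [Fintype α] [Fintype β] (p : Ω → ℝ) (X : Ω → α) (Y : Ω → β) : ℝ :=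
  -∑ a, ∑ b, prob p (fun ω => (X ω, Y ω)) (a, b) *
    Real.logb 2 (prob p (fun ω => (X ω, Y ω)) (a, b) / prob p Y b)

end Shannon

namespace PIR

open Shannon

/-- The possible contents of a file of `L` bits. -/
abbrev FileContent (L : ℕ) : Type := Fin L → ZMod 2

section Schemes

variable {V F : Type*}

/-- The files stored on the server `v`; the file `f` is stored on the two ends of `ends f`. -/
abbrev Stored (ends : F → Sym2 V) (v : V) : Type _ := {f : F // v ∈ ends f}

/-- The files stored on the server `v`, other than `θ`. -/
abbrev StoredExcept (ends : F → Sym2 V) (v : V) (θ : F) : Type _ :=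
  {f : F // v ∈ ends f ∧ f ≠ θ}

variable [Fintype V] [DecidableEq V] [Fintype F] [DecidableEq F]

/-- The data of a retrieval protocol, without the requirements on it. The set `V` of servers and
the set `F` of files form a multigraph, in which the file `f` is an edge with ends `ends f`. -/
structure Protocol (ends : F → Sym2 V) where
  /-- the number of bits of each file -/
  L : ℕ
  L_pos : 0 < L
  /-- the queries and the answers come from finite alphabets -/
  Query : Type
  [queryFintype : Fintype Query]
  Answer : Type
  [answerFintype : Fintype Answer]
  /-- the joint distribution of the queries to all servers when the file `θ` is desired -/
  queryProb : F → (V → Query) → ℝ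
  queryProb_nonneg : ∀ θ Q, 0 ≤ queryProb θ Q
  queryProb_sum : ∀ θ, ∑ Q, queryProb θ Q = 1
  /-- the answer of a server is a function of its query and of the files that it stores -/
  answer : (v : V) → Query → (Stored ends v → FileContent L) → Answer

attribute [instance] Protocol.queryFintype Protocol.answerFintype

namespace Protocol

variable {ends : F → Sym2 V} (T : Protocol ends)

/-- An outcome consists of the queries to all servers and the contents of all files. -/
abbrev Outcome : Type _ := (V → T.Query) × (F → FileContent T.L)

/-- The law of the outcome when the file `θ` is desired: the files are independent and uniform,
and they are independent of the queries. -/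
def law (θ : F) (ω : T.Outcome) : ℝ :=
  T.queryProb θ ω.1 / Fintype.card (F → FileContent T.L)

/-- `Q_v`, the query to the server `v`. -/
def query (v : V) (ω : T.Outcome) : T.Query := ω.1 v

/-- `W_f`, the content of the file `f`. -/
def file (f : F) (ω : T.Outcome) : FileContent T.L := ω.2 f

/-- The contents of all the files stored on the server `v`. -/
def stored (v : V) (ω : T.Outcome) : Stored ends v → FileContent T.L := fun f => ω.2 f

/-- The contents of all the files stored on the server `v`, other than `θ`. -/
def storedExcept (v : V) (θ : F) (ω : T.Outcome) : StoredExcept ends v θ → FileContent T.L :=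
  fun f => ω.2 f

/-- `A_v`, the answer of the server `v`. -/
def ans (v : V) (ω : T.Outcome) : T.Answer := T.answer v (T.query v ω) (T.stored v ω)

/-- The queries to all servers together with all their answers. -/
def transcript (ω : T.Outcome) : (V → T.Answer) × (V → T.Query) := (fun v => T.ans v ω, ω.1)

/-- Reliability: `H(W_θ | all answers, all queries) = 0` when `θ` is desired. -/
def Reliable : Prop :=
  ∀ θ : F, condEntropy (T.law θ) (T.file θ) T.transcript = 0

/-- Privacy: for each server `v`, the law of its query, its answer and the files that it stores
is the same for all desired files. -/
def IsPrivate : Prop :=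
  ∀ (v : V) (θ θ' : F) (z : T.Query × T.Answer × (Stored ends v → FileContent T.L)),
    prob (T.law θ) (fun ω => (T.query v ω, T.ans v ω, T.stored v ω)) z =
      prob (T.law θ') (fun ω => (T.query v ω, T.ans v ω, T.stored v ω)) z

/-- `R` is the rate `L / ∑ v, H(A_v)`. (For a private protocol the law of `A_v`, and with it this
quotient, is the same for all desired files.) -/
def HasRate (R : ℝ) : Prop :=
  ∀ θ : F, R = T.L / ∑ v, entropy (T.law θ) (T.ans v)

/-- What a server `v` that stores the desired file `W_θ` returns about `W_θ` consists of bits of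
`W_θ`: for every query `q` that `v` can get, there is a finite list `M` of bits, each an
`𝔽₂`-linear combination of the bits of `W_θ`, such that, for any given contents of the other files
on `v`, knowing the answer is the same as knowing the bits `M W_θ`.
Every protocol whose answers are `𝔽₂`-linear functions of the stored bits has this property. -/
def RetrievesBits : Prop :=
  ∀ (θ : F) (v : V) (hv : v ∈ ends θ) (q : T.Query), 0 < prob (T.law θ) (T.query v) q →
    ∃ (k : ℕ) (M : FileContent T.L →ₗ[ZMod 2] (Fin k → ZMod 2)),
      ∀ w w' : Stored ends v → FileContent T.L,
        (∀ f : Stored ends v, f.1 ≠ θ → w f = w' f) →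
          (T.answer v q w = T.answer v q w' ↔ M (w ⟨θ, hv⟩) = M (w' ⟨θ, hv⟩))

open Classical in
/-- The symmetric retrieval property: `H(A_v | Q_v, W_{S_v} \ {W_θ}) = L / 2` for each of the two
servers `v` that store the desired file `W_θ`. -/
def SymmetricRetrieval : Prop :=
  ∀ (θ : F) (v : V), v ∈ ends θ →
    condEntropy (T.law θ) (T.ans v) (fun ω => (T.query v ω, T.storedExcept v θ ω)) = (T.L : ℝ) / 2

end Protocol

/-- A private information retrieval scheme: a reliable and private protocol. -/
structure Scheme (ends : F → Sym2 V) extends Protocol ends where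
  reliable : toProtocol.Reliable
  isPrivate : toProtocol.IsPrivate

/-- The capacity: the supremum of the rates of all schemes, over all file sizes. -/
def capacity (ends : F → Sym2 V) : EReal :=
  sSup {x : EReal | ∃ (T : Scheme ends) (R : ℝ), T.HasRate R ∧ x = (R : EReal)}

end Schemes

/-- The storage of a simple graph `G`: one file for each edge. -/
def graphEnds {V : Type*} (G : SimpleGraph V) : G.edgeSet → Sym2 V := fun e => e.1

/-- The storage of the `r`-multigraph `G^(r)`: the files `(e, 1), …, (e, r)` for each edge `e`. -/
def multigraphEnds {V : Type*} (G : SimpleGraph V) (r : ℕ) : G.edgeSet × Fin r → Sym2 V :=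
  fun f => f.1.1

end PIR

end

/-!
The scheme for the multigraph runs the given scheme `T` once for every nonempty set `S` of indices,
on virtual files: the virtual file at an edge `e` in the run `S` is the sum of parts of the files
`(e, i)` with `i ∈ S`. Each file is cut into `2 ^ (r - 1)` parts, one for each `S ∋ i`, by a
uniformly random invertible linear map. If `(e, j)` is desired, the runs `S ∌ j` serve to learn the
sums of the interfering files at `e`, and the runs `S ∋ j` deliver the part of the desired file.
The two ends of `e` each supply half of a virtual file. So one can arrange, by choosing the random
maps of the two ends jointly (`PIR.Blocks.twist`), that the interference at one end in the run `S ∪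
{j}` is what the other end reveals in the run `S`. The law of the maps that a single server sees
remains uniform and independent of the desired file, which gives privacy. In `2 ^ r - 1` runs of
`T` one thus retrieves `2 ^ (r - 1)` times as many bits; see `PIR.eq_of_multiAnswer_eq` for the
decoding.

This needs that the two ends supply exactly half of the bits, for every query, whereas the
symmetric retrieval property only says so on average over the queries. Therefore the random queries
of `T` are first replaced by a fixed list of `N` query vectors, all of which are used, with a list
for each desired file, such that each server finds the same queries in all lists and supplies
exactly half of the bits on the whole list. The conditions on the law of the queries are linear
with integer coefficients, and so they have a rational solution near every real one
(`exists_nat_vector_of_real_vector`, `exists_balanced_list`). The rate does not suffer: by Gibbs'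
inequality the entropy of the answers is at most the cross-entropy relative to the law of the
answers of `T`, which is linear in the law of the queries and can be kept from growing.

Finally, since the ranks on the list add up, the subspaces that the answers of the two ends leave
open are complementary and of the same dimension, so that an automorphism carries one to the other
(`Submodule.exists_linearEquiv_mem_iff`); it is the one used in the twist.
-/

/-! ### Entropy -/

namespace Shannon

variable {Ω α β : Type*} [Fintype Ω]

lemma sum_prob_mul [Fintype α] (p : Ω → ℝ) (X : Ω → α) (g : α → ℝ) :
    ∑ a, prob p X a * g a = ∑ ω, p ω * g (X ω) := by
  classical
  simp only [prob, Finset.sum_mul]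
  rw [Finset.sum_comm]
  refine Finset.sum_congr rfl fun ω _ => ?_
  simp [ite_mul]

lemma sum_prob [Fintype α] (p : Ω → ℝ) (X : Ω → α) : ∑ a, prob p X a = ∑ ω, p ω := by
  simpa using sum_prob_mul p X fun _ => 1

lemma entropy_eq_sum [Fintype α] (p : Ω → ℝ) (X : Ω → α) :
    entropy p X = ∑ ω, p ω * -Real.logb 2 (prob p X (X ω)) := by
  rw [entropy, sum_prob_mul p X fun a => Real.logb 2 (prob p X a)]
  simp

lemma condEntropy_eq_sum [Fintype α] [Fintype β] (p : Ω → ℝ) (X : Ω → α) (Y : Ω → β) :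
    condEntropy p X Y = ∑ ω, p ω *
      -Real.logb 2 (prob p (fun ω => (X ω, Y ω)) (X ω, Y ω) / prob p Y (Y ω)) := by
  have h := sum_prob_mul p (fun ω => (X ω, Y ω)) fun c =>
    Real.logb 2 (prob p (fun ω => (X ω, Y ω)) c / prob p Y c.2)
  rw [Fintype.sum_prod_type] at h
  rw [condEntropy, h]
  simp

lemma prob_nonneg {p : Ω → ℝ} (hp : ∀ ω, 0 ≤ p ω) (X : Ω → α) (a : α) : 0 ≤ prob p X a := by
  classical
  exact Finset.sum_nonneg fun ω _ => by split_ifs <;> simp [hp]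

lemma prob_pos {p : Ω → ℝ} (hp : ∀ ω, 0 ≤ p ω) (X : Ω → α) {ω : Ω} (hω : 0 < p ω) :
    0 < prob p X (X ω) := by
  classical
  refine Finset.sum_pos' (fun ω _ => by split_ifs <;> simp [hp]) ⟨ω, Finset.mem_univ _, ?_⟩
  simpa using hω

lemma prob_le_one {p : Ω → ℝ} (hp : ∀ ω, 0 ≤ p ω) (hp1 : ∑ ω, p ω = 1) (X : Ω → α) (a : α) :
    prob p X a ≤ 1 := by
  classical
  rw [← hp1]
  exact Finset.sum_le_sum fun ω _ => by split_ifs <;> simp [hp]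

lemma prob_pair_le {p : Ω → ℝ} (hp : ∀ ω, 0 ≤ p ω) (X : Ω → α) (Y : Ω → β) (a : α) (b : β) :
    prob p (fun ω => (X ω, Y ω)) (a, b) ≤ prob p Y b := by
  classical
  refine Finset.sum_le_sum fun ω _ => ?_
  simp only [Prod.mk.injEq]
  split_ifs <;> simp_all

lemma entropy_nonneg [Fintype α] {p : Ω → ℝ} (hp : ∀ ω, 0 ≤ p ω) (hp1 : ∑ ω, p ω = 1)
    (X : Ω → α) : 0 ≤ entropy p X := by
  rw [entropy_eq_sum]
  refine Finset.sum_nonneg fun ω _ => mul_nonneg (hp ω) (neg_nonneg.2 ?_)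
  exact Real.logb_nonpos one_lt_two (prob_nonneg hp X _) (prob_le_one hp hp1 X _)

/-- A random variable of entropy zero is constant on the support of the law. -/
lemma eq_of_entropy_eq_zero [Fintype α] {p : Ω → ℝ} (hp : ∀ ω, 0 ≤ p ω) (hp1 : ∑ ω, p ω = 1)
    {X : Ω → α} (h : entropy p X = 0) {ω ω' : Ω} (hω : 0 < p ω) (hω' : 0 < p ω') :
    X ω = X ω' := by
  classical
  have one : ∀ ω, 0 < p ω → prob p X (X ω) = 1 := by
    intro ω hω
    rw [entropy_eq_sum, Finset.sum_eq_zero_iff_of_nonneg] at h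
    · have h1 := h ω (Finset.mem_univ _)
      have h2 := prob_pos hp X hω
      have h3 : Real.logb 2 (prob p X (X ω)) = 0 := by
        simpa [hω.ne'] using h1
      rcases Real.logb_eq_zero.1 h3 with h | h | h | h | h | h <;> linarith
    · exact fun ω _ => mul_nonneg (hp ω) (neg_nonneg.2 (Real.logb_nonpos one_lt_two
        (prob_nonneg hp X _) (prob_le_one hp hp1 X _)))
  by_contra hne
  have hs := sum_prob p X
  have : ∑ a ∈ {X ω, X ω'}, prob p X a ≤ ∑ a, prob p X a :=
    Finset.sum_le_sum_of_subset_of_nonneg (Finset.subset_univ _) fun a _ _ => prob_nonneg hp X a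
  rw [Finset.sum_pair hne, one ω hω, one ω' hω', hs, hp1] at this
  linarith

/-- Gibbs' inequality: the entropy is at most the cross-entropy relative to any other law. -/
lemma entropy_le_crossEntropy [Fintype α] {p : Ω → ℝ} (hp : ∀ ω, 0 ≤ p ω) (hp1 : ∑ ω, p ω = 1)
    (X : Ω → α) {q : α → ℝ} (hq : ∀ a, 0 ≤ q a) (hq1 : ∑ a, q a = 1)
    (hpos : ∀ ω, 0 < p ω → 0 < q (X ω)) :
    entropy p X ≤ ∑ ω, p ω * -Real.logb 2 (q (X ω)) := by
  classical
  rw [entropy_eq_sum, ← sub_nonpos, ← Finset.sum_sub_distrib]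
  have hlog : (0 : ℝ) < Real.log 2 := Real.log_pos one_lt_two
  have key : ∀ ω, p ω * -Real.logb 2 (prob p X (X ω)) - p ω * -Real.logb 2 (q (X ω)) ≤
      (p ω * (q (X ω) / prob p X (X ω)) - p ω) / Real.log 2 := by
    intro ω
    rcases (hp ω).eq_or_lt with h0 | h0
    · simp [← h0]
    · have h1 := hpos ω h0
      have h2 := prob_pos hp X h0
      have h3 := Real.log_le_sub_one_of_pos (div_pos h1 h2)
      rw [Real.log_div h1.ne' h2.ne'] at h3
      rw [Real.logb, Real.logb, le_div_iff₀ hlog]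
      have := mul_le_mul_of_nonneg_left h3 h0.le
      field_simp at this ⊢
      linarith
  refine (Finset.sum_le_sum fun ω _ => key ω).trans ?_
  rw [← Finset.sum_div, Finset.sum_sub_distrib, hp1,
    ← sum_prob_mul p X fun a => q a / prob p X a]
  refine div_nonpos_of_nonpos_of_nonneg (sub_nonpos.2 ?_) hlog.le
  rw [← hq1]
  refine Finset.sum_le_sum fun a _ => ?_
  by_cases h : prob p X a = 0
  · simp [h, hq]
  · rw [mul_div_cancel₀ _ h]

/-- The entropy of `X` given `Y` vanishes exactly when `Y` determines `X` on the support. -/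
lemma condEntropy_eq_zero_iff [Fintype α] [Fintype β] {p : Ω → ℝ} (hp : ∀ ω, 0 ≤ p ω)
    (X : Ω → α) (Y : Ω → β) :
    condEntropy p X Y = 0 ↔ ∀ ω ω', 0 < p ω → 0 < p ω' → Y ω = Y ω' → X ω = X ω' := by
  classical
  rw [condEntropy_eq_sum, Finset.sum_eq_zero_iff_of_nonneg]
  · constructor
    · intro h ω ω' hω hω' hY
      by_contra hne
      have h1 := h ω (Finset.mem_univ _)
      have h2 := prob_pos hp (fun ω => (X ω, Y ω)) hω
      have h3 := prob_pos hp Y hω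
      have h4 : prob p (fun ω => (X ω, Y ω)) (X ω, Y ω) < prob p Y (Y ω) := by
        refine Finset.sum_lt_sum (fun ω _ => ?_) ⟨ω', Finset.mem_univ _, ?_⟩
        · simp only [Prod.mk.injEq]
          split_ifs <;> simp_all
        · simp [← hY, Ne.symm hne, hω']
      have h5 := Real.logb_neg one_lt_two (div_pos h2 h3) ((div_lt_one h3).2 h4)
      simp [hω.ne', h5.ne] at h1
    · intro h ω _
      rcases (hp ω).eq_or_lt with h0 | h0
      · simp [← h0]
      · have h3 := prob_pos hp Y h0
        have : prob p (fun ω => (X ω, Y ω)) (X ω, Y ω) = prob p Y (Y ω) := by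
          refine Finset.sum_congr rfl fun ω' _ => ?_
          rcases (hp ω').eq_or_lt with h0' | h0'
          · simp [← h0']
          · by_cases hY : Y ω' = Y ω
            · simp [hY, h ω' ω h0' h0 hY]
            · simp [hY]
        rw [this, div_self h3.ne']
        simp
  · intro ω _
    refine mul_nonneg (hp ω) (neg_nonneg.2 (Real.logb_nonpos one_lt_two ?_ ?_))
    · exact div_nonneg (prob_nonneg hp _ _) (prob_nonneg hp _ _)
    · exact div_le_one_of_le₀ (prob_pair_le hp X Y _ _) (prob_nonneg hp _ _)

end Shannon

/-! ### Protocols, and their properties without entropies -/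

lemma Shannon.prob_comp {Ω α β : Type*} [Fintype Ω] [Fintype α] (p : Ω → ℝ) (X : Ω → α)
    (g : α → β) (b : β) [DecidableEq β] :
    prob p (fun ω => g (X ω)) b = ∑ a, prob p X a * if g a = b then 1 else 0 := by
  rw [sum_prob_mul p X fun a => if g a = b then 1 else 0]
  refine Finset.sum_congr rfl fun ω _ => ?_
  by_cases h : g (X ω) = b <;> simp [h]

namespace PIR

open Shannon

variable {V F : Type*} [Fintype V] [DecidableEq V] [Fintype F] [DecidableEq F]
  {ends : F → Sym2 V}

namespace Protocol

variable (T : Protocol ends)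

/-- Expectations under the law of the outcome. -/
lemma sum_law_mul (θ : F) (g : T.Outcome → ℝ) :
    ∑ ω, T.law θ ω * g ω = ∑ Q, T.queryProb θ Q *
      ((∑ W, g (Q, W)) / Fintype.card (F → FileContent T.L)) := by
  rw [Fintype.sum_prod_type]
  refine Finset.sum_congr rfl fun Q _ => ?_
  rw [Finset.sum_div, Finset.mul_sum]
  refine Finset.sum_congr rfl fun W _ => ?_
  simp only [law]
  ring

lemma sum_law_mul_query (θ : F) (g : (V → T.Query) → ℝ) :
    ∑ ω, T.law θ ω * g ω.1 = ∑ Q, T.queryProb θ Q * g Q := by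
  have h0 : (Fintype.card (F → FileContent T.L) : ℝ) ≠ 0 := Nat.cast_ne_zero.2 Fintype.card_ne_zero
  rw [T.sum_law_mul θ fun ω => g ω.1]
  refine Finset.sum_congr rfl fun Q _ => ?_
  change T.queryProb θ Q * ((∑ _W : F → FileContent T.L, g Q) / _) = _
  rw [Finset.sum_const, Finset.card_univ, nsmul_eq_mul, mul_div_cancel_left₀ _ h0]

lemma law_nonneg (θ : F) (ω : T.Outcome) : 0 ≤ T.law θ ω :=
  div_nonneg (T.queryProb_nonneg _ _) (Nat.cast_nonneg _)

lemma law_pos_iff (θ : F) (ω : T.Outcome) : 0 < T.law θ ω ↔ 0 < T.queryProb θ ω.1 := by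
  have : (0 : ℝ) < Fintype.card (F → FileContent T.L) := Nat.cast_pos.2 Fintype.card_pos
  rw [law, div_pos_iff_of_pos_right this]

lemma sum_law (θ : F) : ∑ ω, T.law θ ω = 1 := by
  simpa [T.queryProb_sum] using T.sum_law_mul_query θ fun _ => 1

lemma prob_law_comp {α : Type*} [DecidableEq α] (θ : F) (X : T.Outcome → α) (a : α) :
    prob (T.law θ) X a = ∑ Q, T.queryProb θ Q *
      ((∑ W, if X (Q, W) = a then (1 : ℝ) else 0) / Fintype.card (F → FileContent T.L)) := by
  rw [← T.sum_law_mul θ fun ω => if X ω = a then 1 else 0]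
  refine Finset.sum_congr rfl fun ω _ => ?_
  by_cases h : X ω = a <;> simp [h]

lemma prob_query (θ : F) (v : V) (q : T.Query) :
    prob (T.law θ) (T.query v) q = ∑ Q, T.queryProb θ Q * Set.indicator {q} 1 (Q v) := by
  classical
  have h0 : (Fintype.card (F → FileContent T.L) : ℝ) ≠ 0 := Nat.cast_ne_zero.2 Fintype.card_ne_zero
  rw [prob_law_comp]
  refine Finset.sum_congr rfl fun Q _ => ?_
  by_cases h : Q v = q <;> simp [query, h, -Fintype.card_pi]

lemma prob_query_pos {θ : F} {Q : V → T.Query} (hQ : 0 < T.queryProb θ Q) (v : V) :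
    0 < prob (T.law θ) (T.query v) (Q v) :=
  prob_pos (T.law_nonneg θ) (T.query v) (ω := (Q, 0)) ((T.law_pos_iff θ _).2 hQ)

/-- Reliability without entropies: whatever the queries, the answers determine the desired file. -/
lemma reliable_iff : T.Reliable ↔ ∀ θ Q, 0 < T.queryProb θ Q → ∀ W W' : F → FileContent T.L,
    (∀ v, T.answer v (Q v) (fun f => W f) = T.answer v (Q v) fun f => W' f) → W θ = W' θ := by
  refine forall_congr' fun θ => ?_
  rw [condEntropy_eq_zero_iff (T.law_nonneg θ)]
  constructor
  · intro h Q hQ W W' hW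
    refine h (Q, W) (Q, W') ((T.law_pos_iff θ _).2 hQ) ((T.law_pos_iff θ _).2 hQ) ?_
    exact Prod.ext (funext hW) rfl
  · rintro h ⟨Q, W⟩ ⟨Q', W'⟩ hω - hY
    obtain rfl : Q = Q' := congrArg Prod.snd hY
    exact h Q ((T.law_pos_iff θ _).1 hω) W W' (congrFun (congrArg Prod.fst hY))

/-- Privacy in terms of the queries alone: what a server sees depends on the desired file only
through the law of its query. -/
lemma isPrivate_iff : T.IsPrivate ↔ ∀ v θ θ' q,
    prob (T.law θ) (T.query v) q = prob (T.law θ') (T.query v) q := by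
  classical
  constructor
  · intro h v θ θ' q
    have := fun θ => prob_comp (T.law θ) (fun ω => (T.query v ω, T.ans v ω, T.stored v ω))
      Prod.fst q
    simp only at this
    rw [this, this]
    exact Finset.sum_congr rfl fun z _ => by rw [h v θ θ' z]
  · intro h v θ θ' z
    have key : ∀ θ, prob (T.law θ) (fun ω => (T.query v ω, T.ans v ω, T.stored v ω)) z =
        ∑ q, prob (T.law θ) (T.query v) q *
          ((∑ W : F → FileContent T.L,
            if (q, T.answer v q (fun f => W f), fun f : Stored ends v => W f) = z
            then (1 : ℝ) else 0) / Fintype.card (F → FileContent T.L)) := by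
      intro θ
      rw [prob_law_comp]
      simp only [prob_query, Finset.sum_mul]
      rw [Finset.sum_comm]
      refine Finset.sum_congr rfl fun Q _ => ?_
      rw [Finset.sum_eq_single (Q v)]
      · rw [Set.indicator_of_mem (Set.mem_singleton _), Pi.one_apply, mul_one]
        rfl
      · intro q _ hq
        simp [hq.symm]
      · simp
    rw [key, key]
    exact Finset.sum_congr rfl fun q _ => by rw [h v θ θ' q]

/-- The symmetric retrieval property in terms of the parts `K q` of the desired file that the
answer to the query `q` leaves open: their dimension is `L / 2` on average. -/
lemma SymmetricRetrieval.sum_finrank {T : Protocol ends} (h : T.SymmetricRetrieval) {θ : F} {v : V}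
    (hv : v ∈ ends θ) (K : T.Query → Submodule (ZMod 2) (FileContent T.L))
    (hK : ∀ q, 0 < prob (T.law θ) (T.query v) q → ∀ w w' : Stored ends v → FileContent T.L,
      (∀ f : Stored ends v, f.1 ≠ θ → w f = w' f) →
        (T.answer v q w = T.answer v q w' ↔ w ⟨θ, hv⟩ - w' ⟨θ, hv⟩ ∈ K q)) :
    ∑ Q, T.queryProb θ Q * Module.finrank (ZMod 2) (K (Q v)) = T.L / 2 := by
  classical
  have h0 : (Fintype.card (F → FileContent T.L) : ℝ) ≠ 0 := Nat.cast_ne_zero.2 Fintype.card_ne_zero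
  have key : ∀ ω, T.law θ ω * -Real.logb 2
      (prob (T.law θ) (fun ω => (T.ans v ω, (T.query v ω, T.storedExcept v θ ω)))
        (T.ans v ω, (T.query v ω, T.storedExcept v θ ω)) /
        prob (T.law θ) (fun ω => (T.query v ω, T.storedExcept v θ ω))
          (T.query v ω, T.storedExcept v θ ω)) =
      T.law θ ω * (T.L - Module.finrank (ZMod 2) (K (ω.1 v))) := by
    rintro ⟨Q, W⟩
    rcases (T.law_nonneg θ (Q, W)).eq_or_lt with hω | hω
    · rw [← hω, zero_mul, zero_mul]
    congr 1
    have hQ := (T.law_pos_iff θ _).1 hω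
    have hq := T.prob_query_pos hQ v
    -- `A`: the contents that agree with `W` on the other files of `v`; `B`: those that moreover
    -- give the same answer
    set A : Finset (F → FileContent T.L) := Fintype.piFinset fun f =>
      if f = θ then Finset.univ else if v ∈ ends f then {W f} else Finset.univ with hA
    set B : Finset (F → FileContent T.L) := Fintype.piFinset fun f =>
      if f = θ then Finset.univ.filter (fun x : FileContent T.L => x - W θ ∈ K (Q v))
        else if v ∈ ends f then {W f} else Finset.univ with hB
    have hmemA : ∀ W', W' ∈ A ↔ T.storedExcept v θ (Q, W') = T.storedExcept v θ (Q, W) := by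
      intro W'
      rw [hA, Fintype.mem_piFinset, funext_iff]
      constructor
      · rintro hf ⟨f, hf1, hf2⟩
        have := hf f
        simp only [if_neg hf2, if_pos hf1, Finset.mem_singleton] at this
        exact this
      · intro hf f
        by_cases hf2 : f = θ
        · simp [hf2]
        · by_cases hf1 : v ∈ ends f
          · simp only [if_neg hf2, if_pos hf1, Finset.mem_singleton]
            exact hf ⟨f, hf1, hf2⟩
          · simp [hf1, hf2]
    have hmemB : ∀ W', W' ∈ B ↔ T.ans v (Q, W') = T.ans v (Q, W) ∧
        T.storedExcept v θ (Q, W') = T.storedExcept v θ (Q, W) := by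
      intro W'
      have hsplit : W' ∈ B ↔ W' ∈ A ∧ W' θ - W θ ∈ K (Q v) := by
        rw [hA, hB, Fintype.mem_piFinset, Fintype.mem_piFinset]
        constructor
        · intro hf
          refine ⟨fun f => ?_, by simpa using hf θ⟩
          have := hf f
          by_cases hf2 : f = θ
          · simp [hf2]
          · simpa [hf2] using this
        · rintro ⟨hf, hθ⟩ f
          by_cases hf2 : f = θ
          · subst hf2; simpa using hθ
          · simpa [hf2] using hf f
      rw [hsplit, hmemA, and_comm]
      refine and_congr_left fun hex => ?_
      have := hK (Q v) hq (fun f => W' f) (fun f => W f)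
        (fun f hf => congrFun hex ⟨f.1, f.2, hf⟩)
      exact this.symm
    -- the two probabilities are in the ratio of the sizes of `B` and `A`
    have hnum : prob (T.law θ) (fun ω => (T.ans v ω, (T.query v ω, T.storedExcept v θ ω)))
        (T.ans v (Q, W), (T.query v (Q, W), T.storedExcept v θ (Q, W))) =
        prob (T.law θ) (T.query v) (Q v) * (B.card / Fintype.card (F → FileContent T.L)) := by
      rw [prob_law_comp, prob_query, Finset.sum_mul]
      refine Finset.sum_congr rfl fun Q' _ => ?_
      by_cases hQ' : Q' v = Q v
      · rw [hQ', Set.indicator_of_mem (Set.mem_singleton _), Pi.one_apply, mul_one]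
        congr 2
        rw [Finset.sum_boole]
        congr 2
        ext W'
        simp only [Finset.mem_filter, Finset.mem_univ, true_and, hmemB, Prod.mk.injEq]
        simp only [ans, query, hQ', true_and]
        rfl
      · simp [query, hQ']
    have hden : prob (T.law θ) (fun ω => (T.query v ω, T.storedExcept v θ ω))
        (T.query v (Q, W), T.storedExcept v θ (Q, W)) =
        prob (T.law θ) (T.query v) (Q v) * (A.card / Fintype.card (F → FileContent T.L)) := by
      rw [prob_law_comp, prob_query, Finset.sum_mul]
      refine Finset.sum_congr rfl fun Q' _ => ?_
      by_cases hQ' : Q' v = Q v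
      · rw [hQ', Set.indicator_of_mem (Set.mem_singleton _), Pi.one_apply, mul_one]
        congr 2
        rw [Finset.sum_boole]
        congr 2
        ext W'
        simp only [Finset.mem_filter, Finset.mem_univ, true_and, hmemA, Prod.mk.injEq]
        simp only [query, hQ', true_and]
        rfl
      · simp [query, hQ']
    have hcardK : (Finset.univ.filter
        (fun x : FileContent T.L => x - W θ ∈ K (Q v))).card =
        2 ^ Module.finrank (ZMod 2) (K (Q v)) := by
      have h1 := Module.natCard_eq_pow_finrank (K := ZMod 2) (V := K (Q v))
      rw [Nat.card_zmod] at h1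
      rw [← h1, Nat.card_eq_fintype_card, Fintype.card_subtype,
        ← Finset.card_map (Equiv.subRight (W θ)).toEmbedding]
      congr 1
      ext x
      simp
    have hcard : B.card * 2 ^ T.L = A.card * 2 ^ Module.finrank (ZMod 2) (K (Q v)) := by
      rw [hA, hB, Fintype.card_piFinset, Fintype.card_piFinset,
        ← Finset.mul_prod_erase _ _ (Finset.mem_univ θ),
        ← Finset.mul_prod_erase _ _ (Finset.mem_univ θ), if_pos rfl, if_pos rfl, hcardK]
      have : (Finset.univ : Finset (FileContent T.L)).card = 2 ^ T.L := by simp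
      rw [this]
      have : ∀ f ∈ Finset.univ.erase θ, (if f = θ then Finset.univ.filter
          (fun x : FileContent T.L => x - W θ ∈ K (Q v))
          else if v ∈ ends f then {W f} else Finset.univ).card =
          (if f = θ then Finset.univ else if v ∈ ends f then {W f} else Finset.univ).card := by
        intro f hf
        rw [if_neg (Finset.ne_of_mem_erase hf), if_neg (Finset.ne_of_mem_erase hf)]
      rw [Finset.prod_congr rfl this]
      ring
    have hApos : (0 : ℝ) < A.card := Nat.cast_pos.2 (Finset.card_pos.2 ⟨W, (hmemA W).2 rfl⟩)
    have hcard' : (B.card : ℝ) * 2 ^ T.L = A.card * 2 ^ Module.finrank (ZMod 2) (K (Q v)) := by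
      exact_mod_cast hcard
    have hratio : prob (T.law θ) (fun ω => (T.ans v ω, (T.query v ω, T.storedExcept v θ ω)))
        (T.ans v (Q, W), (T.query v (Q, W), T.storedExcept v θ (Q, W))) /
        prob (T.law θ) (fun ω => (T.query v ω, T.storedExcept v θ ω))
        (T.query v (Q, W), T.storedExcept v θ (Q, W)) =
        (2 : ℝ) ^ Module.finrank (ZMod 2) (K (Q v)) / 2 ^ T.L := by
      rw [hnum, hden, mul_div_mul_left _ _ hq.ne', div_div_div_cancel_right₀ h0,
        div_eq_div_iff hApos.ne' (by positivity), hcard', mul_comm]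
    rw [hratio, Real.logb_div (by positivity) (by positivity), Real.logb_pow, Real.logb_pow,
      Real.logb_self_eq_one one_lt_two]
    ring
  have h2 : condEntropy (T.law θ) (T.ans v) (fun ω => (T.query v ω, T.storedExcept v θ ω)) =
      T.L / 2 := by convert h θ v hv
  rw [condEntropy_eq_sum, Finset.sum_congr rfl fun ω _ => key ω,
    T.sum_law_mul_query θ fun Q => (T.L - Module.finrank (ZMod 2) (K (Q v)) : ℝ)] at h2
  simp only [mul_sub, Finset.sum_sub_distrib, ← Finset.sum_mul, T.queryProb_sum, one_mul] at h2
  linarith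

end Protocol

namespace Scheme

/-- The total entropy of the answers is positive: otherwise they would be constant and the desired
file could not be read off from them. -/
lemma sum_entropy_pos (T : Scheme ends) (θ : F) : 0 < ∑ v, entropy (T.law θ) (T.ans v) := by
  have hnn : ∀ v ∈ Finset.univ, 0 ≤ entropy (T.law θ) (T.ans v) := fun v _ =>
    entropy_nonneg (T.law_nonneg θ) (T.sum_law θ) _
  refine lt_of_le_of_ne (Finset.sum_nonneg hnn) fun h => ?_
  rw [eq_comm, Finset.sum_eq_zero_iff_of_nonneg hnn] at h
  obtain ⟨Q, hQ⟩ : ∃ Q, 0 < T.queryProb θ Q := by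
    by_contra! hne
    have h1 := Finset.sum_nonpos fun Q (_ : Q ∈ Finset.univ) => hne Q
    rw [T.queryProb_sum] at h1
    linarith
  have h2 := T.toProtocol.reliable_iff.1 T.reliable θ Q hQ (fun _ _ => 0) (fun _ _ => 1) fun v =>
    eq_of_entropy_eq_zero (T.law_nonneg θ) (T.sum_law θ) (h v (Finset.mem_univ v))
      (ω := (Q, fun _ _ => 0)) (ω' := (Q, fun _ _ => 1))
      ((T.law_pos_iff θ _).2 hQ) ((T.law_pos_iff θ _).2 hQ)
  exact zero_ne_one (congrFun h2 ⟨0, T.L_pos⟩)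

lemma entropy_ans_eq (T : Scheme ends) (v : V) (θ θ' : F) :
    entropy (T.law θ) (T.ans v) = entropy (T.law θ') (T.ans v) := by
  classical
  have : ∀ a, prob (T.law θ) (T.ans v) a = prob (T.law θ') (T.ans v) a := by
    intro a
    have := fun θ => prob_comp (T.law θ) (fun ω => (T.query v ω, T.ans v ω, T.stored v ω))
      (fun z => z.2.1) a
    simp only at this
    rw [this, this]
    exact Finset.sum_congr rfl fun z _ => by rw [T.isPrivate v θ θ' z]
  simp only [entropy, this]

lemma hasRate (T : Scheme ends) (θ : F) :
    T.HasRate (T.L / ∑ v, entropy (T.law θ) (T.ans v)) := fun θ' => by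
  simp only [T.entropy_ans_eq _ θ θ']

end Scheme

/-- A protocol in which the queries are functions `qry θ h` of the desired file `θ` and of a
uniformly distributed `h : H`. The types of queries and answers are replaced by copies in the
lowest universe, as `Protocol` asks. -/
noncomputable def uniformProtocol (ends : F → Sym2 V) {L : ℕ} (hL : 0 < L) {H 𝒬 𝒜 : Type*}
    [Fintype H] [Nonempty H] [Fintype 𝒬] [Fintype 𝒜] (qry : F → H → V → 𝒬)
    (answer : (v : V) → 𝒬 → (Stored ends v → FileContent L) → 𝒜) : Protocol ends where
  L := L
  L_pos := hL
  Query := Fin (Fintype.card 𝒬)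
  Answer := Fin (Fintype.card 𝒜)
  queryProb θ Q :=
    (∑ h, if (fun v => Fintype.equivFin 𝒬 (qry θ h v)) = Q then 1 else 0) / Fintype.card H
  queryProb_nonneg θ Q := div_nonneg (Finset.sum_nonneg fun _ _ => by split_ifs <;> simp)
    (Nat.cast_nonneg _)
  queryProb_sum θ := by
    rw [← Finset.sum_div, Finset.sum_comm]
    simp
  answer v q w := Fintype.equivFin 𝒜 (answer v ((Fintype.equivFin 𝒬).symm q) w)

section Uniform

variable {L : ℕ} (hL : 0 < L) {H 𝒬 𝒜 : Type*} [Fintype H]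
    [Nonempty H] [Fintype 𝒬] [Fintype 𝒜] (qry : F → H → V → 𝒬)
    (answer : (v : V) → 𝒬 → (Stored ends v → FileContent L) → 𝒜)

omit [Fintype F] [DecidableEq F] in
lemma equivFin_symm_uniformProtocol_ans (v : V) (q : V → 𝒬) (W : F → FileContent L) :
    (Fintype.equivFin 𝒜).symm ((uniformProtocol ends hL qry answer).ans v
      (fun v => Fintype.equivFin 𝒬 (q v), W)) = answer v (q v) fun f => W f := by
  refine (Equiv.symm_apply_eq _).2 ?_
  exact congrArg (fun q => Fintype.equivFin 𝒜 (answer v q fun f => W f))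
    ((Fintype.equivFin 𝒬).symm_apply_apply (q v))

omit [Fintype F] [DecidableEq F] in
lemma sum_uniformProtocol_queryProb_mul (θ : F) (g : (V → Fin (Fintype.card 𝒬)) → ℝ) :
    ∑ Q, (uniformProtocol ends hL qry answer).queryProb θ Q * g Q =
      (∑ h, g fun v => Fintype.equivFin 𝒬 (qry θ h v)) / Fintype.card H := by
  have : ∑ Q : V → Fin (Fintype.card 𝒬),
      (∑ h, if (fun v => Fintype.equivFin 𝒬 (qry θ h v)) = Q then (1 : ℝ) else 0) /
        Fintype.card H * g Q =
      (∑ h, g fun v => Fintype.equivFin 𝒬 (qry θ h v)) / Fintype.card H := by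
    simp only [div_mul_eq_mul_div, Finset.sum_mul, ← Finset.sum_div]
    rw [Finset.sum_comm]
    simp
  exact this

omit [Fintype F] [DecidableEq F] in
lemma exists_of_uniformProtocol_queryProb_pos {θ : F} {Q : V → Fin (Fintype.card 𝒬)}
    (hQ : 0 < (uniformProtocol ends hL qry answer).queryProb θ Q) :
    ∃ h, (fun v => Fintype.equivFin 𝒬 (qry θ h v)) = Q := by
  by_contra! hne
  have : (uniformProtocol ends hL qry answer).queryProb θ Q =
      (∑ h, if (fun v => Fintype.equivFin 𝒬 (qry θ h v)) = Q then (1 : ℝ) else 0) /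
        Fintype.card H := rfl
  simp [this, hne] at hQ

lemma uniformProtocol_reliable (hrel : ∀ θ h (W W' : F → FileContent L),
      (∀ v, answer v (qry θ h v) (fun f => W f) = answer v (qry θ h v) fun f => W' f) →
        W θ = W' θ) :
    (uniformProtocol ends hL qry answer).Reliable := by
  rw [Protocol.reliable_iff]
  intro θ Q hQ W W' hW
  obtain ⟨h, rfl⟩ := exists_of_uniformProtocol_queryProb_pos hL qry answer hQ
  refine hrel θ h W W' fun v => ?_
  simpa [uniformProtocol] using hW v

/-- The protocol is private if changing the desired file amounts, for each server, to a permutation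
of the uniform randomness. -/
lemma uniformProtocol_isPrivate
    (hpriv : ∀ v θ θ', ∃ σ : Equiv.Perm H, ∀ h, qry θ h v = qry θ' (σ h) v) :
    (uniformProtocol ends hL qry answer).IsPrivate := by
  rw [Protocol.isPrivate_iff]
  intro v θ θ' q
  have key : ∀ θ, prob ((uniformProtocol ends hL qry answer).law θ)
      ((uniformProtocol ends hL qry answer).query v) q =
      (∑ h, Set.indicator {q} (1 : Fin (Fintype.card 𝒬) → ℝ) (Fintype.equivFin 𝒬 (qry θ h v))) /
        Fintype.card H := by
    intro θ
    rw [Protocol.prob_query]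
    exact sum_uniformProtocol_queryProb_mul (ends := ends) hL qry answer θ
      fun Q => Set.indicator {q} (1 : Fin (Fintype.card 𝒬) → ℝ) (Q v)
  obtain ⟨σ, hσ⟩ := hpriv v θ θ'
  rw [key, key, ← Equiv.sum_comp σ fun h => Set.indicator {q} (1 : Fin (Fintype.card 𝒬) → ℝ)
    (Fintype.equivFin 𝒬 (qry θ' h v))]
  simp only [hσ]

/-- The entropy of an answer is at most its cross-entropy relative to a law `p`, here written as an
average over the uniform `h` and `W`. -/
lemma entropy_uniformProtocol_ans_le (θ : F) (v : V) {p : 𝒜 → ℝ} (hp : ∀ a, 0 ≤ p a)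
    (hp1 : ∑ a, p a = 1)
    (hpos : ∀ h (W : F → FileContent L), 0 < p (answer v (qry θ h v) fun f => W f)) :
    entropy ((uniformProtocol ends hL qry answer).law θ)
        ((uniformProtocol ends hL qry answer).ans v) ≤
      (∑ h, (∑ W : F → FileContent L, -Real.logb 2 (p (answer v (qry θ h v) fun f => W f))) /
        Fintype.card (F → FileContent L)) / Fintype.card H := by
  set U := uniformProtocol ends hL qry answer with hU
  have hans : ∀ h (W : F → FileContent L), (Fintype.equivFin 𝒜).symm
      (U.ans v (fun v => Fintype.equivFin 𝒬 (qry θ h v), W)) =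
        answer v (qry θ h v) fun f => W f := fun h W =>
    equivFin_symm_uniformProtocol_ans hL qry answer v (qry θ h) W
  refine (entropy_le_crossEntropy (U.law_nonneg θ) (U.sum_law θ) (U.ans v)
    (q := fun a => p ((Fintype.equivFin 𝒜).symm a)) (fun a => hp _) ?_ ?_).trans (le_of_eq ?_)
  · rw [← hp1]
    exact Equiv.sum_comp (Fintype.equivFin 𝒜).symm p
  · rintro ⟨Q, W⟩ hQ
    obtain ⟨h, rfl⟩ := exists_of_uniformProtocol_queryProb_pos hL qry answer
      ((U.law_pos_iff θ _).1 hQ)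
    rw [hans h W]
    exact hpos h W
  · rw [U.sum_law_mul θ fun ω => -Real.logb 2 (p ((Fintype.equivFin 𝒜).symm (U.ans v ω)))]
    have := sum_uniformProtocol_queryProb_mul (ends := ends) hL qry answer θ fun Q =>
      (∑ W : F → FileContent L, -Real.logb 2 (p ((Fintype.equivFin 𝒜).symm (U.ans v (Q, W))))) /
        Fintype.card (F → FileContent L)
    refine this.trans ?_
    simp only [hans]

end Uniform

end PIR

/-! ### Rational query lists -/

/-- A nonnegative real vector `x` can be replaced by a vector `n` of natural numbers that satisfies
every integer linear relation satisfied by `x`, without making a given linear functional positive.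
Write the entries of `x` in a `ℚ`-basis of their span: moving the basis elements, as independent
real variables, to nearby rational numbers preserves all the integer relations. -/
lemma exists_nat_vector_of_real_vector {I : Type*} [Fintype I] (x ℓ : I → ℝ) (hx : ∀ i, 0 ≤ x i)
    (hx0 : x ≠ 0) (hℓ : ∑ i, ℓ i * x i ≤ 0) :
    ∃ n : I → ℕ, n ≠ 0 ∧ (∀ a : I → ℤ, ∑ i, (a i : ℝ) * x i = 0 → ∑ i, a i * (n i : ℤ) = 0) ∧
      ∑ i, ℓ i * n i ≤ 0 := by
  classical
  let W : Submodule ℚ ℝ := Submodule.span ℚ (Set.range x)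
  have : FiniteDimensional ℚ W := FiniteDimensional.span_of_finite ℚ (Set.finite_range x)
  let b := Module.finBasis ℚ W
  have hmem : ∀ i, x i ∈ W := fun i => Submodule.subset_span ⟨i, rfl⟩
  -- `D i` holds the coordinates of `x i`; `y t i` is `x i` with the basis `b` replaced by `t`
  let D : I → Fin (Module.finrank ℚ W) → ℚ := fun i k => b.repr ⟨x i, hmem i⟩ k
  let y : (Fin (Module.finrank ℚ W) → ℝ) → I → ℝ := fun t i => ∑ k, (D i k : ℝ) * t k
  let t₀ : Fin (Module.finrank ℚ W) → ℝ := fun k => (b k : ℝ)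
  have hy₀ : y t₀ = x := by
    funext i
    have := congrArg (Subtype.val) (b.sum_repr ⟨x i, hmem i⟩)
    simp only [AddSubmonoidClass.coe_finsetSum, Submodule.coe_smul, Rat.smul_def] at this
    exact this
  have hrel : ∀ a : I → ℚ, ∑ i, (a i : ℝ) * x i = 0 → ∀ k, ∑ i, a i * D i k = 0 := by
    intro a ha k
    have h1 : ∑ i, a i • (⟨x i, hmem i⟩ : W) = 0 := by
      apply Subtype.ext
      simpa [Rat.smul_def] using ha
    have h2 := congrArg (fun w => b.repr w k) h1
    simp only [map_sum, map_smul, Finsupp.coe_finsetSum, Finset.sum_apply, Finsupp.smul_apply,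
      smul_eq_mul, map_zero, Finsupp.coe_zero, Pi.zero_apply] at h2
    exact h2
  have hy_cont : ∀ i, Continuous fun t => y t i := fun i => by fun_prop
  have hy_zero : ∀ i, x i = 0 → ∀ t, y t i = 0 := by
    intro i hi t
    have : ∀ k, D i k = 0 := fun k => by
      have h : (⟨x i, hmem i⟩ : W) = 0 := Subtype.ext hi
      simp [D, h]
    simp [y, this]
  let Λ : (Fin (Module.finrank ℚ W) → ℝ) → ℝ := fun t => ∑ i, ℓ i * y t i
  have hΛ_cont : Continuous Λ := by fun_prop
  -- find a rational `s` near `t₀` that keeps the nonzero entries positive and `Λ` nonpositive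
  have hopen : IsOpen {t | ∀ i, x i ≠ 0 → 0 < y t i} := by
    simp only [Set.ofPred_forall]
    refine isOpen_iInter_of_finite fun i => isOpen_iInter_of_finite fun _ => ?_
    exact isOpen_lt continuous_const (hy_cont i)
  have ht₀ : t₀ ∈ {t | ∀ i, x i ≠ 0 → 0 < y t i} := fun i hi => by
    rw [hy₀]; exact lt_of_le_of_ne (hx i) hi.symm
  have hdense : DenseRange fun (s : Fin (Module.finrank ℚ W) → ℚ) k => ((s k : ℚ) : ℝ) :=
    DenseRange.piMap fun _ => Rat.denseRange_cast
  obtain ⟨s, hs, hsΛ⟩ : ∃ s : Fin (Module.finrank ℚ W) → ℚ,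
      (∀ i, x i ≠ 0 → 0 < y (fun k => s k) i) ∧ Λ (fun k => s k) ≤ 0 := by
    by_cases hΛ : ∀ t, Λ t = 0
    · obtain ⟨s, hs⟩ := hdense.exists_mem_open hopen ⟨t₀, ht₀⟩
      exact ⟨s, hs, (hΛ _).le⟩
    · push Not at hΛ
      obtain ⟨d, hd⟩ := hΛ
      have hlin : ∀ (c : ℝ), Λ (t₀ + c • d) = Λ t₀ + c * Λ d := by
        intro c
        simp only [Λ, y, Pi.add_apply, Pi.smul_apply, smul_eq_mul, mul_add, Finset.sum_add_distrib,
          Finset.mul_sum]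
        congr 1
        refine Finset.sum_congr rfl fun i _ => Finset.sum_congr rfl fun k _ => by ring
      -- a small step from `t₀` in the direction `-Λ d • d` makes `Λ` negative
      have hΛ₀ : Λ t₀ ≤ 0 := by simpa [Λ, hy₀] using hℓ
      have hev : ∀ᶠ c : ℝ in nhds 0, t₀ + (-c * Λ d) • d ∈ {t | ∀ i, x i ≠ 0 → 0 < y t i} := by
        have hc : Continuous fun c : ℝ => t₀ + (-c * Λ d) • d := by fun_prop
        exact hc.continuousAt.eventually_mem (hopen.mem_nhds (by simpa using ht₀))
      obtain ⟨c, hc, hcpos⟩ := ((hev.filter_mono nhdsWithin_le_nhds).and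
        (self_mem_nhdsWithin : Set.Ioi (0 : ℝ) ∈ nhdsWithin 0 (Set.Ioi 0))).exists
      have hneg : Λ (t₀ + (-c * Λ d) • d) < 0 := by
        rw [hlin]
        have h1 : 0 < Λ d * Λ d := mul_self_pos.2 hd
        have h2 := mul_pos (Set.mem_Ioi.1 hcpos) h1
        linarith
      obtain ⟨s, hs⟩ := hdense.exists_mem_open
        (hopen.inter (isOpen_lt hΛ_cont continuous_const)) ⟨_, hc, hneg⟩
      exact ⟨s, hs.1, (show _ < _ from hs.2).le⟩
  -- clear the denominators
  let z : I → ℚ := fun i => ∑ k, D i k * s k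
  have hzy : ∀ i, ((z i : ℚ) : ℝ) = y (fun k => s k) i := fun i => by simp [z, y]
  have hz0 : ∀ i, 0 ≤ z i := by
    intro i
    have : (0 : ℝ) ≤ z i := by
      rw [hzy]
      by_cases hi : x i = 0
      · rw [hy_zero i hi]
      · exact (hs i hi).le
    exact_mod_cast this
  let M : ℕ := ∏ i, (z i).den
  have hM : 0 < M := Finset.prod_pos fun i _ => (z i).den_pos
  have hint : ∀ i, ∃ m : ℕ, (m : ℚ) = M * z i := by
    intro i
    obtain ⟨q, hq⟩ := Finset.dvd_prod_of_mem (fun i => (z i).den) (Finset.mem_univ i)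
    refine ⟨q * (z i).num.toNat, ?_⟩
    have h1 : (((z i).num.toNat : ℤ) : ℚ) = (z i).num := by
      rw [Int.toNat_of_nonneg (Rat.num_nonneg.2 (hz0 i))]
    have h2 : (z i).den * z i = (z i).num := Rat.den_mul_eq_num (z i)
    simp only [M, hq]
    push_cast at h1 ⊢
    rw [h1, ← h2]
    ring
  choose n hn using hint
  have hn' : ∀ i, (n i : ℝ) = M * y (fun k => s k) i := fun i => by
    rw [← hzy]; exact_mod_cast congrArg (fun q : ℚ => (q : ℝ)) (hn i)
  refine ⟨n, ?_, ?_, ?_⟩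
  · obtain ⟨i, hi⟩ := Function.ne_iff.1 hx0
    intro h
    have h1 := hn' i
    have h2 := mul_pos (Nat.cast_pos (α := ℝ).2 hM) (hs i hi)
    simp [h] at h1
    rcases h1 with h1 | h1
    · omega
    · exact (hs i hi).ne' h1
  · intro a ha
    have h1 := hrel (fun i => a i) (by simpa using ha)
    have : ∑ i, (a i : ℚ) * n i = 0 := by
      simp only [hn, z, Finset.mul_sum]
      rw [Finset.sum_comm]
      refine Finset.sum_eq_zero fun k _ => ?_
      have := congrArg (fun q => (M : ℚ) * q * s k) (h1 k)
      simp only [Finset.mul_sum, Finset.sum_mul, mul_zero, zero_mul] at this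
      rw [← this]
      exact Finset.sum_congr rfl fun i _ => by ring
    exact_mod_cast this
  · have : ∑ i, ℓ i * (n i : ℝ) = M * Λ fun k => s k := by
      simp only [hn', Λ, Finset.mul_sum]
      exact Finset.sum_congr rfl fun i _ => by ring
    rw [this]
    exact mul_nonpos_of_nonneg_of_nonpos (by positivity) hsΛ

/-- Derandomization of the queries. The laws `x e` on `V → 𝒬` have marginals that do not depend
on `e`, and the quantities `m e v` have mean zero whenever `P e v`. Then each `x e` can be replaced
by the uniform law on a list `c e` of length `N` (with repetitions) such that the lists of different
`e` have the same entries at `v`, up to the order `σ e v`, the sums of the `m e v` are still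
exactly zero, and the average of `cost` does not grow. -/
lemma exists_balanced_list {V E 𝒬 : Type*} [Fintype V] [DecidableEq V] [Fintype E] [Fintype 𝒬]
    (x : E → (V → 𝒬) → ℝ) (hx : ∀ e Q, 0 ≤ x e Q) (hx1 : ∀ e, ∑ Q, x e Q = 1)
    (hmarg : ∀ v e e' q, ∑ Q, x e Q * Set.indicator {q} 1 (Q v) =
      ∑ Q, x e' Q * Set.indicator {q} 1 (Q v))
    (P : E → V → Prop) (m : E → V → 𝒬 → ℤ)
    (hm : ∀ e v, P e v → ∑ Q, x e Q * m e v (Q v) = 0) (e₀ : E) (cost : (V → 𝒬) → ℝ) :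
    ∃ (N : ℕ) (c : E → Fin N → V → 𝒬) (b : V → Fin N → 𝒬) (σ : E → V → Equiv.Perm (Fin N)),
      0 < N ∧ (∀ e n, 0 < x e (c e n)) ∧ (∀ e v n, b v (σ e v n) = c e n v) ∧
      (∀ e v, P e v → ∑ n, m e v (c e n v) = 0) ∧
      ∑ n, cost (c e₀ n) ≤ N * ∑ Q, x e₀ Q * cost Q := by
  classical
  set κ := ∑ Q, x e₀ Q * cost Q with hκ
  have hsum : ∀ (e : E) {R : Type} [CommRing R] (g : (V → 𝒬) → R) (y : E × (V → 𝒬) → R),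
      ∑ i : E × (V → 𝒬), (if i.1 = e then g i.2 else 0) * y i = ∑ Q, g Q * y (e, Q) := by
    intro e R _ g y
    rw [Fintype.sum_prod_type, Finset.sum_eq_single e]
    · simp
    · intro e' _ he'
      simp [he']
    · simp
  obtain ⟨n, hn0, hrel, hcost⟩ := exists_nat_vector_of_real_vector
    (fun i : E × (V → 𝒬) => x i.1 i.2) (fun i => if i.1 = e₀ then cost i.2 - κ else 0)
    (fun i => hx _ _) (by
      intro h
      have h1 := hx1 e₀
      have h2 : ∀ Q, x e₀ Q = 0 := fun Q => congrFun h (e₀, Q)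
      simp [h2] at h1) (by
      rw [hsum e₀ (fun Q => cost Q - κ)]
      simp only [sub_mul, Finset.sum_sub_distrib, ← Finset.mul_sum, hx1, mul_one]
      rw [hκ, sub_nonpos]
      exact le_of_eq (Finset.sum_congr rfl fun Q _ => mul_comm _ _))
  have hzero : ∀ (e : E) (g : (V → 𝒬) → ℤ), ∑ Q, x e Q * g Q = 0 →
      ∑ Q, g Q * (n (e, Q) : ℤ) = 0 := by
    intro e g hg
    have := hrel (fun i => if i.1 = e then g i.2 else 0) (by
      push_cast
      rw [hsum e (fun Q => (g Q : ℝ)), ← hg]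
      exact Finset.sum_congr rfl fun Q _ => mul_comm _ _)
    rwa [hsum e g] at this
  have heq : ∀ (e e' : E) (g : (V → 𝒬) → ℤ), ∑ Q, x e Q * g Q = ∑ Q, x e' Q * g Q →
      ∑ Q, g Q * (n (e, Q) : ℤ) = ∑ Q, g Q * (n (e', Q) : ℤ) := by
    intro e e' g hg
    have := hrel (fun i => (if i.1 = e then g i.2 else 0) - if i.1 = e' then g i.2 else 0) (by
      push_cast
      simp only [sub_mul, Finset.sum_sub_distrib]
      rw [hsum e (fun Q => (g Q : ℝ)), hsum e' (fun Q => (g Q : ℝ)), sub_eq_zero]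
      simpa only [mul_comm] using hg)
    simp only [sub_mul, Finset.sum_sub_distrib] at this
    rwa [hsum e g, hsum e' g, sub_eq_zero] at this
  have hsupp : ∀ e Q, n (e, Q) ≠ 0 → 0 < x e Q := by
    intro e Q hne
    refine lt_of_le_of_ne (hx e Q) fun h0 => hne ?_
    have := hzero e (Pi.single Q 1) (by
      refine Finset.sum_eq_zero fun Q' _ => ?_
      by_cases hQ : Q' = Q
      · simp [hQ, ← h0]
      · simp [hQ])
    simpa [Pi.single_apply] using this
  -- all the files have lists of the same length
  set N := ∑ Q, n (e₀, Q) with hN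
  have hcard : ∀ e, ∑ Q, n (e, Q) = N := by
    intro e
    have := heq e e₀ (fun _ => 1) (by simp [hx1])
    simp only [one_mul] at this
    exact_mod_cast this
  let ε : ∀ e, Fin N ≃ Σ Q, Fin (n (e, Q)) := fun e =>
    Fintype.equivOfCardEq (by simp [hcard])
  let c : E → Fin N → V → 𝒬 := fun e k => (ε e k).1
  have hc : ∀ e {R : Type} [CommRing R] (g : (V → 𝒬) → R),
      ∑ k, g (c e k) = ∑ Q, g Q * (n (e, Q) : R) := by
    intro e R _ g
    rw [Equiv.sum_comp (ε e) fun z => g z.1, Fintype.sum_sigma]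
    simp [mul_comm]
  have hfib : ∀ e v q, Fintype.card {k // c e k v = q} = Fintype.card {k // c e₀ k v = q} := by
    intro e v q
    have key : ∀ e, (Fintype.card {k // c e k v = q} : ℤ) =
        ∑ Q, Set.indicator {q} (1 : 𝒬 → ℤ) (Q v) * (n (e, Q) : ℤ) := by
      intro e
      rw [← hc e fun Q => Set.indicator {q} (1 : 𝒬 → ℤ) (Q v), Fintype.card_subtype]
      simp [Set.indicator_apply]
    have hcast : ∀ z, ((Set.indicator {q} (1 : 𝒬 → ℤ) z : ℤ) : ℝ) =
        Set.indicator {q} (1 : 𝒬 → ℝ) z := fun z => by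
      by_cases h : z = q <;> simp [h]
    have := heq e e₀ (fun Q => Set.indicator {q} (1 : 𝒬 → ℤ) (Q v)) (by
      simpa only [hcast] using hmarg v e e₀ q)
    rw [← key, ← key] at this
    exact_mod_cast this
  refine ⟨N, c, fun v k => c e₀ k v, fun e v => Equiv.ofFiberEquiv
    (f := fun k => c e k v) (g := fun k => c e₀ k v) fun q => Fintype.equivOfCardEq (hfib e v q),
    ?_, ?_, ?_, ?_, ?_⟩
  · refine Nat.pos_of_ne_zero fun h0 => hn0 (funext fun i => ?_)
    have := hcard i.1
    rw [h0, Finset.sum_eq_zero_iff] at this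
    exact this i.2 (Finset.mem_univ _)
  · intro e k
    exact hsupp e _ fun h0 => (Fin.cast h0 (ε e k).2).elim0
  · intro e v k
    exact Equiv.ofFiberEquiv_map (f := fun k => c e k v) (g := fun k => c e₀ k v) _ k
  · intro e v hP
    rw [hc e fun Q => m e v (Q v)]
    exact hzero e (fun Q => m e v (Q v)) (hm e v hP)
  · rw [hc e₀ cost]
    rw [hsum e₀ (fun Q => cost Q - κ) (fun i => (n i : ℝ))] at hcost
    simp only [sub_mul, Finset.sum_sub_distrib, ← Finset.mul_sum] at hcost
    have : (N : ℝ) = ∑ Q, (n (e₀, Q) : ℝ) := by rw [hN]; push_cast; rfl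
    rw [this]
    linarith

/-! ### Linear algebra and counting -/

lemma Submodule.finrank_pi_univ {K ι M : Type*} [Field K] [AddCommGroup M] [Module K M]
    [FiniteDimensional K M] [Fintype ι] (p : ι → Submodule K M) :
    Module.finrank K (Submodule.pi Set.univ p) = ∑ i, Module.finrank K (p i) := by
  rw [← Module.finrank_pi_fintype K]
  refine LinearEquiv.finrank_eq
    { toFun := fun x i => ⟨x.1 i, x.2 i (Set.mem_univ i)⟩
      invFun := fun y => ⟨fun i => y i, fun i _ => (y i).2⟩
      map_add' := fun _ _ => rfl
      map_smul' := fun _ _ => rfl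
      left_inv := fun _ => rfl
      right_inv := fun _ => rfl }

/-- Two subspaces of the same dimension are carried to each other by an automorphism. -/
lemma Submodule.exists_linearEquiv_mem_iff {K X : Type*} [Field K] [AddCommGroup X] [Module K X]
    [FiniteDimensional K X] {p q : Submodule K X}
    (h : Module.finrank K p = Module.finrank K q) :
    ∃ τ : X ≃ₗ[K] X, ∀ x, x ∈ p ↔ τ x ∈ q := by
  obtain ⟨τ, hτ⟩ := Submodule.exists_linearEquiv_restrict_eq (LinearEquiv.ofFinrankEq p q h)
  refine ⟨τ, fun x => ⟨fun hx => ?_, fun hx => ?_⟩⟩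
  · rw [← hτ ⟨x, hx⟩]
    exact SetLike.coe_mem _
  · have h1 := hτ ((LinearEquiv.ofFinrankEq p q h).symm ⟨τ x, hx⟩)
    rw [LinearEquiv.apply_symm_apply] at h1
    rw [τ.injective h1]
    exact SetLike.coe_mem _

/-- A surjective homomorphism preserves averages, as its fibres have the same size. -/
lemma sum_comp_div_card_of_surjective {A B : Type*} [AddCommGroup A] [AddCommGroup B] [Fintype A]
    [Fintype B] (φ : A →+ B) (hφ : Function.Surjective φ) (f : B → ℝ) :
    (∑ a, f (φ a)) / Fintype.card A = (∑ b, f b) / Fintype.card B := by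
  classical
  set k := Fintype.card φ.ker
  have hfib : ∀ b, (Finset.univ.filter fun a => φ a = b).card = k := by
    intro b
    obtain ⟨a, rfl⟩ := hφ b
    rw [← Fintype.card_subtype]
    refine Fintype.card_congr ((Equiv.subRight a).subtypeEquiv fun x => ?_)
    simp [AddMonoidHom.mem_ker, sub_eq_zero]
  have hsum : ∀ g : B → ℝ, ∑ a, g (φ a) = k * ∑ b, g b := by
    intro g
    rw [← Finset.sum_fiberwise Finset.univ φ, Finset.mul_sum]
    refine Finset.sum_congr rfl fun b _ => ?_
    rw [Finset.sum_congr rfl (g := fun _ => g b) fun a ha => by rw [(Finset.mem_filter.1 ha).2],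
      Finset.sum_const, hfib, nsmul_eq_mul]
  have hk : (k : ℝ) ≠ 0 := Nat.cast_ne_zero.2 Fintype.card_ne_zero
  have hcard : (Fintype.card A : ℝ) = k * Fintype.card B := by simpa using hsum fun _ => 1
  rw [hsum, hcard, mul_div_mul_left _ _ hk]

lemma card_finset_mem (r : ℕ) (i : Fin r) :
    Fintype.card {S : Finset (Fin r) // i ∈ S} = 2 ^ (r - 1) := by
  have := Finset.card_Icc_finset (Finset.subset_univ ({i} : Finset (Fin r)))
  rw [Finset.card_univ, Fintype.card_fin, Finset.card_singleton] at this
  rw [Fintype.card_subtype, ← this]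
  congr 1
  ext S
  simp

lemma card_finset_nonempty (r : ℕ) :
    Fintype.card {S : Finset (Fin r) // S.Nonempty} = 2 ^ r - 1 := by
  simp only [Finset.nonempty_iff_ne_empty, ne_eq]
  rw [Fintype.card_subtype_compl]
  simp

/-! ### The construction for the multigraph -/

namespace PIR

open Shannon

/-- The content of a file `(e, i)` of the multigraph, cut into blocks: one copy of a content for the
original scheme for each run `S ∋ i` of that scheme and each of the `N` queries of a list. -/
abbrev Blocks (r N L : ℕ) (i : Fin r) : Type :=
  {S : Finset (Fin r) // i ∈ S} → Fin N → FileContent L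

namespace Blocks

variable {r N L : ℕ} {i : Fin r}

/-- The part of a file that enters the run `S`; it is zero if the file does not take part in `S`. -/
def read (S : Finset (Fin r)) : Blocks r N L i →ₗ[ZMod 2] (Fin N → FileContent L) :=
  if h : i ∈ S then LinearMap.proj (⟨S, h⟩ : {S : Finset (Fin r) // i ∈ S}) else 0

lemma read_of_mem (x : Blocks r N L i) {S : Finset (Fin r)} (h : i ∈ S) :
    read S x = x ⟨S, h⟩ := by
  rw [read, dif_pos h, LinearMap.proj_apply]

lemma read_of_notMem (x : Blocks r N L i) {S : Finset (Fin r)} (h : i ∉ S) :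
    read S x = 0 := by
  rw [read, dif_neg h, LinearMap.zero_apply]

/-- Renumbering the `N` copies by `π`, in every run. -/
def reindex (i : Fin r) (π : Equiv.Perm (Fin N)) : Blocks r N L i ≃ₗ[ZMod 2] Blocks r N L i :=
  LinearEquiv.piCongrRight fun _ => LinearEquiv.funCongrLeft (ZMod 2) (FileContent L) π.symm

lemma read_reindex (π : Equiv.Perm (Fin N)) (x : Blocks r N L i) (S : Finset (Fin r))
    (n : Fin N) : read S (reindex i π x) (π n) = read S x n := by
  by_cases h : i ∈ S
  · rw [read_of_mem _ h, read_of_mem _ h]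
    simp [reindex, LinearEquiv.funCongrLeft_apply, LinearMap.funLeft_apply]
  · rw [read_of_notMem _ h, read_of_notMem _ h]
    rfl

/-- Toggling the element `j` in the subsets that contain `i`. -/
def toggle {i j : Fin r} (h : i ≠ j) : Equiv.Perm {S : Finset (Fin r) // i ∈ S} :=
  Function.Involutive.toPerm
    (fun S => ⟨symmDiff S.1 {j}, by
      simp [Finset.mem_symmDiff, S.2, h]⟩)
    fun S => Subtype.ext (by simp)

/-- Exchanging the parts that enter the runs `S` and `S ∪ {j}`, for all `S ∌ j`, and applying `τ`
to all parts. -/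
def twist {i j : Fin r} (h : i ≠ j)
    (τ : (Fin N → FileContent L) ≃ₗ[ZMod 2] (Fin N → FileContent L)) :
    Blocks r N L i ≃ₗ[ZMod 2] Blocks r N L i :=
  LinearEquiv.funCongrLeft (ZMod 2) (Fin N → FileContent L) (toggle h) ≪≫ₗ
    LinearEquiv.piCongrRight fun _ => τ

lemma read_twist {j : Fin r} (h : i ≠ j)
    (τ : (Fin N → FileContent L) ≃ₗ[ZMod 2] (Fin N → FileContent L)) (x : Blocks r N L i)
    (S : Finset (Fin r)) : read S (twist h τ x) = τ (read (symmDiff S {j}) x) := by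
  have hmem : i ∈ symmDiff S {j} ↔ i ∈ S := by simp [Finset.mem_symmDiff, h]
  by_cases hi : i ∈ S
  · rw [read_of_mem _ hi, read_of_mem _ (hmem.2 hi)]
    rfl
  · rw [read_of_notMem _ hi, read_of_notMem _ (mt hmem.1 hi), map_zero]

end Blocks

variable {V F : Type*} [Fintype V] [DecidableEq V] [DecidableEq F]
  {ends : F → Sym2 V}

/-- The storage of the multigraph with `r` files `(e, 1), …, (e, r)` for each file `e`. -/
abbrev multiEnds (ends : F → Sym2 V) (r : ℕ) : F × Fin r → Sym2 V := fun f => ends f.1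

section Construction

variable (T : Protocol ends) (r N : ℕ) (b : V → Fin N → T.Query)

/-- The queries of the scheme for the multigraph: for each file an invertible linear map that cuts
it into blocks. (Queries also cover the files that a server does not store; those parts are
ignored.) -/
abbrev Scramble : Type _ :=
  ∀ f : F × Fin r, FileContent (2 ^ (r - 1) * N * T.L) ≃ₗ[ZMod 2] Blocks r N T.L f.2

variable {T r N}

/-- The content, in the run `S`, of the virtual file at `e`, for all `N` copies: the sum of the
parts of those files `(e, i)` that take part in the run. -/
def virtualFile (g : Scramble T r N) (S : Finset (Fin r)) (e : F)
    (w : Fin r → FileContent (2 ^ (r - 1) * N * T.L)) : Fin N → FileContent T.L :=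
  ∑ i, Blocks.read S (g (e, i) (w i))

/-- The answers of the server `v`: in each run `S ≠ ∅` it applies the original scheme to the virtual
files, with the `k`-th copy of the files used for the `k`-th query `b v k` of a fixed list. -/
def multiAnswer (v : V) (g : Scramble T r N)
    (w : Stored (multiEnds ends r) v → FileContent (2 ^ (r - 1) * N * T.L))
    (z : {S : Finset (Fin r) // S.Nonempty} × Fin N) : T.Answer :=
  T.answer v (b v z.2) fun e => virtualFile g z.1 e.1 (fun i => w ⟨(e.1, i), e.2⟩) z.2

/-- The change of blocks by which the queries to the two ends of the desired edge differ: at the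
end `v ≠ u θ.1` the interfering files on that edge are twisted. Elsewhere it is the identity. (At a
server that is not an end of the edge the twist would also occur, but such a server does not store
the file.) -/
def crossOver (u : F → V) (τ : F → (Fin N → FileContent T.L) ≃ₗ[ZMod 2] (Fin N → FileContent T.L))
    (θ f : F × Fin r) (v : V) : Blocks r N T.L f.2 ≃ₗ[ZMod 2] Blocks r N T.L f.2 :=
  if h : f.1 = θ.1 ∧ v ≠ u θ.1 ∧ f.2 ≠ θ.2 then Blocks.twist h.2.2 (τ θ.1) else LinearEquiv.refl _ _

/-- The query to the server `v` when `θ` is desired, with `h` uniformly distributed. The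
renumbering `σ θ.1 v` puts the copies in the order in which `v` finds its queries in its list. -/
def multiQuery (σ : F → V → Equiv.Perm (Fin N)) (u : F → V)
    (τ : F → (Fin N → FileContent T.L) ≃ₗ[ZMod 2] (Fin N → FileContent T.L))
    (θ : F × Fin r) (h : Scramble T r N) (v : V) : Scramble T r N :=
  fun f => h f ≪≫ₗ crossOver u τ θ f v ≪≫ₗ Blocks.reindex f.2 (σ θ.1 v)

/-- For each server, changing the desired file composes the uniform `h` with fixed invertible maps;
hence the scheme is private. -/
lemma exists_perm_multiQuery (σ : F → V → Equiv.Perm (Fin N)) (u : F → V)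
    (τ : F → (Fin N → FileContent T.L) ≃ₗ[ZMod 2] (Fin N → FileContent T.L)) (v : V)
    (θ θ' : F × Fin r) : ∃ π : Equiv.Perm (Scramble T r N), ∀ h,
      multiQuery σ u τ θ h v = multiQuery σ u τ θ' (π h) v := by
  let κ (θ : F × Fin r) : Equiv.Perm (Scramble T r N) := Equiv.piCongrRight fun f =>
    { toFun := fun g => g ≪≫ₗ crossOver u τ θ f v ≪≫ₗ Blocks.reindex f.2 (σ θ.1 v)
      invFun := fun g => g ≪≫ₗ (crossOver u τ θ f v ≪≫ₗ Blocks.reindex f.2 (σ θ.1 v)).symm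
      left_inv := fun g => by ext; simp
      right_inv := fun g => by ext; simp }
  refine ⟨(κ θ).trans (κ θ').symm, fun h => ?_⟩
  exact ((κ θ').apply_symm_apply (κ θ h)).symm

/-- The virtual file of the run `S` at `e`, as the server `v` sees it, with the copies numbered as
in the list of query vectors of the desired file. -/
def seenFile (u : F → V) (τ : F → (Fin N → FileContent T.L) ≃ₗ[ZMod 2] (Fin N → FileContent T.L))
    (θ : F × Fin r) (h : Scramble T r N) (v : V) (S : Finset (Fin r)) (e : F) :
    (Fin r → FileContent (2 ^ (r - 1) * N * T.L)) →ₗ[ZMod 2] (Fin N → FileContent T.L) :=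
  ∑ i, Blocks.read S ∘ₗ (h (e, i) ≪≫ₗ crossOver u τ θ (e, i) v).toLinearMap ∘ₗ LinearMap.proj i

lemma seenFile_apply (u : F → V)
    (τ : F → (Fin N → FileContent T.L) ≃ₗ[ZMod 2] (Fin N → FileContent T.L))
    (θ : F × Fin r) (h : Scramble T r N) (v : V) (S : Finset (Fin r)) (e : F)
    (w : Fin r → FileContent (2 ^ (r - 1) * N * T.L)) :
    seenFile u τ θ h v S e w = ∑ i, Blocks.read S (crossOver u τ θ (e, i) v (h (e, i) (w i))) := by
  simp [seenFile]

lemma virtualFile_multiQuery (σ : F → V → Equiv.Perm (Fin N)) (u : F → V)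
    (τ : F → (Fin N → FileContent T.L) ≃ₗ[ZMod 2] (Fin N → FileContent T.L))
    (θ : F × Fin r) (h : Scramble T r N) (v : V) (S : Finset (Fin r)) (e : F)
    (w : Fin r → FileContent (2 ^ (r - 1) * N * T.L)) (n : Fin N) :
    virtualFile (multiQuery σ u τ θ h v) S e w (σ θ.1 v n) = seenFile u τ θ h v S e w n := by
  rw [virtualFile, seenFile_apply, Finset.sum_apply, Finset.sum_apply]
  exact Finset.sum_congr rfl fun i _ => Blocks.read_reindex _ _ _ _

/-- Away from the desired edge all servers see the same virtual files. -/
lemma seenFile_of_ne (u : F → V)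
    (τ : F → (Fin N → FileContent T.L) ≃ₗ[ZMod 2] (Fin N → FileContent T.L))
    (θ : F × Fin r) (h : Scramble T r N) (v v' : V) (S : Finset (Fin r)) {e : F} (he : e ≠ θ.1)
    (w : Fin r → FileContent (2 ^ (r - 1) * N * T.L)) :
    seenFile u τ θ h v S e w = seenFile u τ θ h v' S e w := by
  rw [seenFile_apply, seenFile_apply]
  simp [crossOver, he]

lemma seenFile_first (u : F → V)
    (τ : F → (Fin N → FileContent T.L) ≃ₗ[ZMod 2] (Fin N → FileContent T.L))
    (θ : F × Fin r) (h : Scramble T r N) (S : Finset (Fin r))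
    (w : Fin r → FileContent (2 ^ (r - 1) * N * T.L)) :
    seenFile u τ θ h (u θ.1) S θ.1 w = Blocks.read S (h θ (w θ.2)) +
      ∑ i ∈ Finset.univ.erase θ.2, Blocks.read S (h (θ.1, i) (w i)) := by
  rw [seenFile_apply, ← Finset.add_sum_erase _ _ (Finset.mem_univ θ.2)]
  simp [crossOver]

lemma seenFile_second (u : F → V)
    (τ : F → (Fin N → FileContent T.L) ≃ₗ[ZMod 2] (Fin N → FileContent T.L))
    (θ : F × Fin r) (h : Scramble T r N) {v : V} (hv : v ≠ u θ.1) (S : Finset (Fin r))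
    (w : Fin r → FileContent (2 ^ (r - 1) * N * T.L)) :
    seenFile u τ θ h v S θ.1 w = Blocks.read S (h θ (w θ.2)) +
      τ θ.1 (∑ i ∈ Finset.univ.erase θ.2, Blocks.read (symmDiff S {θ.2}) (h (θ.1, i) (w i))) := by
  rw [seenFile_apply, ← Finset.add_sum_erase _ _ (Finset.mem_univ θ.2), map_sum]
  congr 1
  · simp [crossOver]
  · refine Finset.sum_congr rfl fun i hi => ?_
    have hi' : i ≠ θ.2 := Finset.ne_of_mem_erase hi
    rw [crossOver, dif_pos ⟨rfl, hv, hi'⟩, Blocks.read_twist]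

/-- Decoding. `A e` and `A' e` consist of the contents of the `N` copies of the file `e` that the
answers of its two ends do not notice. They are complementary, so for every run there are contents
that look to each of the two ends like the virtual file it sees, and reliability of the original
scheme shows that they are determined by the answers. So each end reveals its virtual file modulo
`A e` or `A' e`. In a run `S` with `j ∈ S` that file is the part `D` of the desired file plus
interference, and the interference at one end is what the run `S ∖ {j}` reveals at the other end. -/
lemma eq_of_multiAnswer_eq (σ : F → V → Equiv.Perm (Fin N)) (u u' : F → V)
    (hends : ∀ e, ends e = s(u e, u' e)) (hu : ∀ e, u' e ≠ u e)
    (c : F → Fin N → V → T.Query) (hb : ∀ e v n, b v (σ e v n) = c e n v)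
    (hrel : ∀ e n (W W' : F → FileContent T.L),
      (∀ v, T.answer v (c e n v) (fun f => W f) = T.answer v (c e n v) fun f => W' f) → W e = W' e)
    (K : F → V → T.Query → Submodule (ZMod 2) (FileContent T.L))
    (hK : ∀ e v (hv : v ∈ ends e) n, ∀ w w' : Stored ends v → FileContent T.L,
      (∀ f : Stored ends v, f.1 ≠ e → w f = w' f) →
        (T.answer v (c e n v) w = T.answer v (c e n v) w' ↔
          w ⟨e, hv⟩ - w' ⟨e, hv⟩ ∈ K e v (c e n v)))
    (A A' : F → Submodule (ZMod 2) (Fin N → FileContent T.L))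
    (hA : ∀ e, A e = Submodule.pi Set.univ fun n => K e (u e) (c e n (u e)))
    (hA' : ∀ e, A' e = Submodule.pi Set.univ fun n => K e (u' e) (c e n (u' e)))
    (hcompl : ∀ e, IsCompl (A e) (A' e))
    (τ : F → (Fin N → FileContent T.L) ≃ₗ[ZMod 2] (Fin N → FileContent T.L))
    (hτ : ∀ e x, x ∈ A e ↔ τ e x ∈ A' e)
    (θ : F × Fin r) (h : Scramble T r N)
    (W W' : F × Fin r → FileContent (2 ^ (r - 1) * N * T.L))
    (hW : ∀ v, multiAnswer b v (multiQuery σ u τ θ h v)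
        (fun f : Stored (multiEnds ends r) v => W f) =
      multiAnswer b v (multiQuery σ u τ θ h v) fun f => W' f) : W θ = W' θ := by
  obtain ⟨e, j⟩ := θ
  have hsplit : ∀ y y' : Fin N → FileContent T.L, ∃ z, z - y ∈ A e ∧ z - y' ∈ A' e := by
    intro y y'
    have : y' - y ∈ A e ⊔ A' e := by rw [(hcompl e).sup_eq_top]; trivial
    obtain ⟨a, ha, a', ha', haa⟩ := Submodule.mem_sup.1 this
    refine ⟨y + a, by simpa using ha, ?_⟩
    have : y + a - y' = -a' := by rw [← sub_eq_zero]; linear_combination haa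
    rw [this]
    exact neg_mem ha'
  -- on the copy `n` of the run `S`, the answers are those of `T` for consistent contents
  have hcopy : ∀ (S : {S : Finset (Fin r) // S.Nonempty}) (n : Fin N)
      (W : F × Fin r → FileContent (2 ^ (r - 1) * N * T.L)) (z : Fin N → FileContent T.L),
      z - seenFile u τ (e, j) h (u e) S e (fun i => W (e, i)) ∈ A e →
      z - seenFile u τ (e, j) h (u' e) S e (fun i => W (e, i)) ∈ A' e → ∀ v,
      multiAnswer b v (multiQuery σ u τ (e, j) h v) (fun f => W f) (S, σ e v n) =
        T.answer v (c e n v) fun f : Stored ends v => if f.1 = e then z n else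
          seenFile u τ (e, j) h (u e) S f (fun i => W (f, i)) n := by
    intro S n W z hz hz' v
    have h1 : multiAnswer b v (multiQuery σ u τ (e, j) h v) (fun f => W f) (S, σ e v n) =
        T.answer v (c e n v) fun f : Stored ends v =>
          seenFile u τ (e, j) h v S f.1 (fun i => W (f.1, i)) n := by
      rw [multiAnswer, hb]
      congr 1
      funext f
      exact virtualFile_multiQuery σ u τ (e, j) h v S f.1 _ n
    rw [h1]
    by_cases hv : v ∈ ends e
    · refine ((hK e v hv n _ _ fun f hf => ?_).2 ?_).symm
      · rw [if_neg hf, seenFile_of_ne u τ (e, j) h (u e) v S hf]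
      · rw [if_pos rfl]
        rw [hends, Sym2.mem_iff] at hv
        rcases hv with rfl | rfl
        · rw [hA] at hz
          exact hz n (Set.mem_univ n)
        · rw [hA'] at hz'
          exact hz' n (Set.mem_univ n)
    · congr 1
      funext f
      have hf : f.1 ≠ e := fun hfe => hv (hfe ▸ f.2)
      rw [if_neg hf, seenFile_of_ne u τ (e, j) h (u e) v S hf]
  have hview : ∀ S : Finset (Fin r), S.Nonempty →
      seenFile u τ (e, j) h (u e) S e (fun i => W (e, i) - W' (e, i)) ∈ A e ∧
      seenFile u τ (e, j) h (u' e) S e (fun i => W (e, i) - W' (e, i)) ∈ A' e := by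
    intro S hS
    obtain ⟨z, hz1, hz2⟩ := hsplit (seenFile u τ (e, j) h (u e) S e fun i => W (e, i))
      (seenFile u τ (e, j) h (u' e) S e fun i => W (e, i))
    obtain ⟨z', hz1', hz2'⟩ := hsplit (seenFile u τ (e, j) h (u e) S e fun i => W' (e, i))
      (seenFile u τ (e, j) h (u' e) S e fun i => W' (e, i))
    have hzz : z = z' := by
      funext n
      have := hrel e n (fun f => if f = e then z n else
          seenFile u τ (e, j) h (u e) S f (fun i => W (f, i)) n)
        (fun f => if f = e then z' n else
          seenFile u τ (e, j) h (u e) S f (fun i => W' (f, i)) n) fun v => by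
          rw [← hcopy ⟨S, hS⟩ n W z hz1 hz2 v, ← hcopy ⟨S, hS⟩ n W' z' hz1' hz2' v, hW v]
      simpa using this
    have hsub : ∀ v, seenFile u τ (e, j) h v S e (fun i => W (e, i) - W' (e, i)) =
        (z' - seenFile u τ (e, j) h v S e fun i => W' (e, i)) -
          (z - seenFile u τ (e, j) h v S e fun i => W (e, i)) := by
      intro v
      have := map_sub (seenFile u τ (e, j) h v S e) (fun i => W (e, i)) (fun i => W' (e, i))
      rw [hzz, sub_sub_sub_cancel_left, ← this]
      rfl
    exact ⟨hsub (u e) ▸ sub_mem hz1' hz1, hsub (u' e) ▸ sub_mem hz2' hz2⟩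
  -- `P S` is the interference in the run `S`, and `D` the difference of the desired files
  set P : Finset (Fin r) → Fin N → FileContent T.L := fun S =>
    ∑ i ∈ Finset.univ.erase j, Blocks.read S (h (e, i) (W (e, i) - W' (e, i))) with hP
  set D : Blocks r N T.L j := h (e, j) (W (e, j) - W' (e, j)) with hD
  have hfirst : ∀ S, Blocks.read S D + P S ∈ A e := by
    intro S
    rcases S.eq_empty_or_nonempty with rfl | hS
    · simp [hP, Blocks.read_of_notMem]
    · have := (hview S hS).1
      rwa [seenFile_first u τ (e, j)] at this
  have hsecond : ∀ S, S.Nonempty → Blocks.read S D + τ e (P (symmDiff S {j})) ∈ A' e := by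
    intro S hS
    have := (hview S hS).2
    rwa [seenFile_second u τ (e, j) h (hu e)] at this
  have hzero : D = 0 := by
    funext ⟨S, hS⟩
    rw [← Blocks.read_of_mem D hS]
    have hjS : j ∉ symmDiff S {j} := by simp [Finset.mem_symmDiff, hS]
    have h1 := hfirst (symmDiff S {j})
    rw [Blocks.read_of_notMem D hjS, zero_add, hτ] at h1
    have h2 := (Submodule.add_mem_iff_left _ h1).1 (hsecond S ⟨j, hS⟩)
    have h3 : P S ∈ A e := by
      rw [hτ]
      rcases (symmDiff S {j}).eq_empty_or_nonempty with hT | hT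
      · have hSj : S = {j} := by
          simpa using hT
        have : P S = 0 := by
          rw [hP, hSj]
          refine Finset.sum_eq_zero fun i hi => Blocks.read_of_notMem _ ?_
          simpa using Finset.ne_of_mem_erase hi
        rw [this, map_zero]
        exact zero_mem _
      · have := hsecond _ hT
        rwa [Blocks.read_of_notMem D hjS, zero_add, symmDiff_symmDiff_cancel_right] at this
    have h4 := (Submodule.add_mem_iff_left _ h3).1 (hfirst S)
    exact (Submodule.mem_bot _).1 ((hcompl e).inf_eq_bot ▸ Submodule.mem_inf.2 ⟨h4, h2⟩)
  rw [hD] at hzero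
  exact sub_eq_zero.1 ((LinearEquiv.map_eq_zero_iff _).1 hzero)

end Construction

end PIR

/-! ### The rate of the construction -/

namespace PIR

open Shannon

variable {V F : Type*} [Fintype V] [DecidableEq V] [Fintype F] [DecidableEq F]
  {ends : F → Sym2 V}

/-- For each query, run and copy, the virtual files are uniformly distributed when the files of the
multigraph are. -/
lemma average_virtualFile (T : Protocol ends) {r N : ℕ} (g : Scramble T r N)
    {S : Finset (Fin r)} (hS : S.Nonempty) (k : Fin N) (f : (F → FileContent T.L) → ℝ) :
    (∑ W : F × Fin r → FileContent (2 ^ (r - 1) * N * T.L),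
        f fun e => virtualFile g S e (fun i => W (e, i)) k) /
        Fintype.card (F × Fin r → FileContent (2 ^ (r - 1) * N * T.L)) =
      (∑ W, f W) / Fintype.card (F → FileContent T.L) := by
  let φ : (F × Fin r → FileContent (2 ^ (r - 1) * N * T.L)) →+ (F → FileContent T.L) :=
    { toFun := fun W e => virtualFile g S e (fun i => W (e, i)) k
      map_zero' := by
        funext e
        simp [virtualFile]
      map_add' := fun W W' => by
        funext e
        simp [virtualFile, Finset.sum_add_distrib] }
  refine sum_comp_div_card_of_surjective φ (fun w => ?_) f
  obtain ⟨i₀, hi₀⟩ := hS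
  refine ⟨fun f => if f.2 = i₀ then (g f).symm fun _ _ => w f.1 else 0, funext fun e => ?_⟩
  change virtualFile g S e (fun i => if i = i₀ then (g (e, i)).symm fun _ _ => w e else 0) k = w e
  rw [virtualFile, Finset.sum_eq_single i₀]
  · rw [if_pos rfl, LinearEquiv.apply_symm_apply, Blocks.read_of_mem _ hi₀]
  · intro i _ hi
    rw [if_neg hi, map_zero, map_zero]
  · simp

omit [Fintype F] [DecidableEq F] in
lemma scramble_nonempty (T : Protocol ends) (r N : ℕ) : Nonempty (Scramble T r N) := by
  refine ⟨fun f => LinearEquiv.ofFinrankEq _ _ ?_⟩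
  rw [Module.finrank_pi, Module.finrank_pi_fintype]
  simp [Module.finrank_pi_fintype, card_finset_mem, mul_assoc]

/-- The scheme for the multigraph: files of `2 ^ (r - 1) * N * L` bits are retrieved at `2 ^ r - 1`
times the cost of `N` uses of the original scheme. -/
lemma exists_multigraph_scheme (hends : ∀ e, ¬ (ends e).IsDiag) (T : Scheme ends)
    (hbits : T.RetrievesBits) (hsrp : T.SymmetricRetrieval) (e₀ : F) {r : ℕ}
    (θ : F × Fin r) :
    ∃ (T' : Scheme (multiEnds ends r)) (N : ℕ), 0 < N ∧ T'.L = 2 ^ (r - 1) * N * T.L ∧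
      ∑ v, entropy (T'.law θ) (T'.ans v) ≤
        (2 ^ r - 1) * (N * ∑ v, entropy (T.law e₀) (T.ans v)) := by
  classical
  obtain ⟨u, u', hu⟩ : ∃ u u' : F → V, ∀ e, ends e = s(u e, u' e) ∧ u' e ≠ u e := by
    have : ∀ e, ∃ a b, ends e = s(a, b) ∧ b ≠ a := by
      intro e
      have h := hends e
      induction hz : ends e using Sym2.ind with
      | _ a b =>
        rw [hz, Sym2.mk_isDiag_iff] at h
        exact ⟨a, b, rfl, Ne.symm h⟩
    choose u u' hu using this
    exact ⟨u, u', hu⟩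
  have hmem : ∀ e, u e ∈ ends e := fun e => by rw [(hu e).1]; exact Sym2.mem_mk_left _ _
  have hmem' : ∀ e, u' e ∈ ends e := fun e => by rw [(hu e).1]; exact Sym2.mem_mk_right _ _
  -- `K e v q` is the part of the file `e` that the answer of `v` to the query `q` leaves open
  have hKex : ∀ e v q, ∃ K : Submodule (ZMod 2) (FileContent T.L), ∀ hv : v ∈ ends e,
      0 < prob (T.law e) (T.query v) q → ∀ w w' : Stored ends v → FileContent T.L,
        (∀ f : Stored ends v, f.1 ≠ e → w f = w' f) →
          (T.answer v q w = T.answer v q w' ↔ w ⟨e, hv⟩ - w' ⟨e, hv⟩ ∈ K) := by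
    intro e v q
    by_cases h : v ∈ ends e ∧ 0 < prob (T.law e) (T.query v) q
    · obtain ⟨k, M, hM⟩ := hbits e v h.1 q h.2
      refine ⟨LinearMap.ker M, fun _ _ w w' hw => ?_⟩
      rw [hM w w' hw, LinearMap.mem_ker, map_sub, sub_eq_zero]
    · exact ⟨⊥, fun h1 h2 => (h ⟨h1, h2⟩).elim⟩
  choose K hK using hKex
  have hhalf : ∀ e v, v ∈ ends e → ∑ Q, T.queryProb e Q *
      ((2 * Module.finrank (ZMod 2) (K e v (Q v)) - T.L : ℤ) : ℝ) = 0 := by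
    intro e v hv
    have := hsrp.sum_finrank hv (K e v) (hK e v · hv)
    push_cast
    simp only [mul_sub, Finset.sum_sub_distrib, ← Finset.sum_mul, T.queryProb_sum,
      mul_left_comm _ (2 : ℝ), ← Finset.mul_sum, this]
    ring
  -- the cross-entropy of the answer to `q` relative to the law of the answers of `v` in `T`; its
  -- mean over the queries is the entropy, and it is linear in the law of the queries
  let cost : V → T.Query → ℝ := fun v q =>
    (∑ W : F → FileContent T.L,
      -Real.logb 2 (prob (T.law e₀) (T.ans v) (T.answer v q fun f => W f))) /
        Fintype.card (F → FileContent T.L)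
  have hcost : ∑ Q, T.queryProb e₀ Q * ∑ v, cost v (Q v) =
      ∑ v, entropy (T.law e₀) (T.ans v) := by
    simp only [Finset.mul_sum]
    rw [Finset.sum_comm]
    refine Finset.sum_congr rfl fun v _ => ?_
    rw [entropy_eq_sum, T.sum_law_mul e₀ fun ω =>
      -Real.logb 2 (prob (T.law e₀) (T.ans v) (T.ans v ω))]
    rfl
  obtain ⟨N, c, b, σ, hN, hc, hb, hbal, hle⟩ := exists_balanced_list T.queryProb
    T.queryProb_nonneg T.queryProb_sum
    (fun v e e' q => by
      rw [← T.prob_query, ← T.prob_query]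
      exact T.isPrivate_iff.1 T.isPrivate v e e' q)
    (fun e v => v ∈ ends e) (fun e v q => 2 * Module.finrank (ZMod 2) (K e v q) - T.L)
    hhalf e₀ (fun Q => ∑ v, cost v (Q v))
  rw [hcost] at hle
  have hrel : ∀ e n (W W' : F → FileContent T.L),
      (∀ v, T.answer v (c e n v) (fun f => W f) = T.answer v (c e n v) fun f => W' f) →
        W e = W' e := fun e n => T.reliable_iff.1 T.reliable e (c e n) (hc e n)
  have hK' : ∀ e v (hv : v ∈ ends e) n, ∀ w w' : Stored ends v → FileContent T.L,
      (∀ f : Stored ends v, f.1 ≠ e → w f = w' f) →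
        (T.answer v (c e n v) w = T.answer v (c e n v) w' ↔
          w ⟨e, hv⟩ - w' ⟨e, hv⟩ ∈ K e v (c e n v)) :=
    fun e v hv n => hK e v _ hv (T.prob_query_pos (hc e n) v)
  let A : F → V → Submodule (ZMod 2) (Fin N → FileContent T.L) := fun e v =>
    Submodule.pi Set.univ fun n => K e v (c e n v)
  have hfin : ∀ e v, v ∈ ends e → 2 * Module.finrank (ZMod 2) (A e v) = N * T.L := by
    intro e v hv
    have := hbal e v hv
    simp only [Finset.sum_sub_distrib, ← Finset.mul_sum, Finset.sum_const, Finset.card_univ,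
      Fintype.card_fin, nsmul_eq_mul, sub_eq_zero] at this
    rw [Submodule.finrank_pi_univ]
    exact_mod_cast this
  have hdisj : ∀ e, Disjoint (A e (u e)) (A e (u' e)) := by
    intro e
    rw [Submodule.disjoint_def]
    intro x hx hx'
    funext n
    have := hrel e n (fun f => if f = e then x n else 0) (fun _ => 0) fun v => by
      by_cases hv : v ∈ ends e
      · refine (hK' e v hv n _ _ fun f hf => if_neg hf).2 ?_
        rw [if_pos rfl, sub_zero]
        rw [(hu e).1, Sym2.mem_iff] at hv
        rcases hv with rfl | rfl
        · exact hx n (Set.mem_univ n)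
        · exact hx' n (Set.mem_univ n)
      · congr 1
        funext f
        exact if_neg fun hfe : f.1 = e => hv (hfe ▸ f.2)
    simpa using this
  have hcompl : ∀ e, IsCompl (A e (u e)) (A e (u' e)) := by
    intro e
    refine ⟨hdisj e, codisjoint_iff.2 (Submodule.eq_top_of_disjoint _ _ ?_ (hdisj e))⟩
    have h1 := hfin e _ (hmem e)
    have h2 := hfin e _ (hmem' e)
    have h3 : Module.finrank (ZMod 2) (Fin N → FileContent T.L) = N * T.L := by
      simp [Module.finrank_pi_fintype]
    omega
  have hτex : ∀ e, ∃ τ : (Fin N → FileContent T.L) ≃ₗ[ZMod 2] (Fin N → FileContent T.L),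
      ∀ x, x ∈ A e (u e) ↔ τ x ∈ A e (u' e) := fun e =>
    Submodule.exists_linearEquiv_mem_iff (by
      have h1 := hfin e _ (hmem e)
      have h2 := hfin e _ (hmem' e)
      omega)
  choose τ hτ using hτex
  have : Nonempty (Scramble T.toProtocol r N) := scramble_nonempty _ _ _
  have : ∀ f : F × Fin r, Finite
      (FileContent (2 ^ (r - 1) * N * T.L) ≃ₗ[ZMod 2] Blocks r N T.L f.2) := fun f =>
    DFunLike.finite _
  have : Fintype (Scramble T.toProtocol r N) := Fintype.ofFinite _
  have hL : 0 < 2 ^ (r - 1) * N * T.L := by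
    have := T.L_pos
    positivity
  let T' : Scheme (multiEnds ends r) :=
    { toProtocol := uniformProtocol (multiEnds ends r) hL (multiQuery σ u τ) (multiAnswer b)
      reliable := uniformProtocol_reliable hL _ _ fun θ h W W' hW =>
        eq_of_multiAnswer_eq b σ u u' (fun e => (hu e).1) (fun e => (hu e).2) c hb hrel K hK'
          (fun e => A e (u e)) (fun e => A e (u' e)) (fun _ => rfl) (fun _ => rfl) hcompl τ hτ
          θ h W W' hW
      isPrivate := uniformProtocol_isPrivate hL _ _ fun v θ θ' =>
        exists_perm_multiQuery σ u τ v θ θ' }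
  refine ⟨T', N, hN, rfl, ?_⟩
  -- compare the law of all answers of `v` with the product of copies of the law in `T`
  have hserver : ∀ v, entropy (T'.law θ) (T'.ans v) ≤ (2 ^ r - 1) * ∑ n, cost v (b v n) := by
    intro v
    set p := prob (T.law e₀) (T.ans v) with hp
    have hp0 : ∀ a, 0 ≤ p a := prob_nonneg (T.law_nonneg e₀) _
    have hp1 : ∑ a, p a = 1 := (sum_prob _ _).trans (T.sum_law e₀)
    have hppos : ∀ n w, 0 < p (T.answer v (b v n) w) := by
      intro n w
      obtain ⟨m, rfl⟩ := (σ e₀ v).surjective n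
      rw [hb]
      have := prob_pos (T.law_nonneg e₀) (T.ans v)
        (ω := (c e₀ m, fun f => if h : v ∈ ends f then w ⟨f, h⟩ else 0))
        ((T.law_pos_iff e₀ _).2 (hc e₀ m))
      convert this using 2
      change _ = T.answer v (c e₀ m v) _
      congr 1
      funext f
      change w f = if h : v ∈ ends f.1 then w ⟨f.1, h⟩ else 0
      rw [dif_pos f.2]
    refine (entropy_uniformProtocol_ans_le hL (multiQuery σ u τ) (multiAnswer b) θ v
      (p := fun a => ∏ z, p (a z)) (fun a => Finset.prod_nonneg fun z _ => hp0 _) ?_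
      fun h W => Finset.prod_pos fun z _ => hppos _ _).trans (le_of_eq ?_)
    · rw [← Fintype.piFinset_univ, ← Finset.prod_univ_sum]
      simp [hp1]
    · have havg : ∀ h, (∑ W : F × Fin r → FileContent (2 ^ (r - 1) * N * T.L),
          -Real.logb 2 (∏ z, p (multiAnswer b v (multiQuery σ u τ θ h v) (fun f => W f) z))) /
          Fintype.card (F × Fin r → FileContent (2 ^ (r - 1) * N * T.L)) =
          (2 ^ r - 1) * ∑ n, cost v (b v n) := by
        intro h
        have hlog : ∀ W : F × Fin r → FileContent (2 ^ (r - 1) * N * T.L),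
            -Real.logb 2 (∏ z, p (multiAnswer b v (multiQuery σ u τ θ h v) (fun f => W f) z)) =
            ∑ z, -Real.logb 2
              (p (multiAnswer b v (multiQuery σ u τ θ h v) (fun f => W f) z)) := fun W => by
          have hne : ∀ z, p (multiAnswer b v (multiQuery σ u τ θ h v) (fun f => W f) z) ≠ 0 :=
            fun z => (hppos _ _).ne'
          rw [Real.logb_prod _ _ fun z _ => hne z, Finset.sum_neg_distrib]
        simp only [hlog]
        rw [Finset.sum_comm, Finset.sum_div]
        have hz : ∀ z : {S : Finset (Fin r) // S.Nonempty} × Fin N,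
            (∑ W : F × Fin r → FileContent (2 ^ (r - 1) * N * T.L), -Real.logb 2
              (p (multiAnswer b v (multiQuery σ u τ θ h v) (fun f => W f) z))) /
              Fintype.card (F × Fin r → FileContent (2 ^ (r - 1) * N * T.L)) =
            cost v (b v z.2) := fun z =>
          average_virtualFile T.toProtocol (multiQuery σ u τ θ h v) z.1.2 z.2 fun W =>
            -Real.logb 2 (p (T.answer v (b v z.2) fun f => W f))
        rw [Finset.sum_congr rfl fun z _ => hz z, Fintype.sum_prod_type]
        change ∑ _S : {S : Finset (Fin r) // S.Nonempty}, ∑ n, cost v (b v n) = _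
        rw [Finset.sum_const, Finset.card_univ, card_finset_nonempty, nsmul_eq_mul,
          Nat.cast_sub Nat.one_le_two_pow]
        push_cast
        rfl
      have hH : (Fintype.card (Scramble T.toProtocol r N) : ℝ) ≠ 0 :=
        Nat.cast_ne_zero.2 Fintype.card_ne_zero
      rw [Finset.sum_congr rfl fun h _ => havg h, Finset.sum_const, Finset.card_univ,
        nsmul_eq_mul, mul_div_cancel_left₀ _ hH]
  have h2r : (0 : ℝ) ≤ 2 ^ r - 1 := sub_nonneg.2 (one_le_pow₀ one_le_two)
  refine (Finset.sum_le_sum fun v _ => hserver v).trans ?_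
  rw [← Finset.mul_sum]
  refine mul_le_mul_of_nonneg_left (le_trans (le_of_eq ?_) hle) h2r
  rw [Finset.sum_comm (γ := Fin N)]
  refine Finset.sum_congr rfl fun v _ => ?_
  rw [← Equiv.sum_comp (σ e₀ v)]
  simp only [hb]

end PIR


theorem theorem1 {V : Type*} [Fintype V] [DecidableEq V] (G : SimpleGraph V) [DecidableRel G.Adj]
    (hG : G.edgeSet.Nonempty) (r : ℕ) (hr : 1 ≤ r)
    (T : PIR.Scheme (PIR.graphEnds G)) (hbits : T.RetrievesBits) (hsrp : T.SymmetricRetrieval)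
    (R : ℝ) (hR : T.HasRate R) :
    (∃ (T' : PIR.Scheme (PIR.multigraphEnds G r)) (R' : ℝ),
        T'.HasRate R' ∧ R * (1 / (2 - 1 / 2 ^ (r - 1))) ≤ R') ∧
      ((R * (1 / (2 - 1 / 2 ^ (r - 1))) : ℝ) : EReal) ≤ PIR.capacity (PIR.multigraphEnds G r) := by
  have main : ∃ (T' : PIR.Scheme (PIR.multigraphEnds G r)) (R' : ℝ),
      T'.HasRate R' ∧ R * (1 / (2 - 1 / 2 ^ (r - 1))) ≤ R' := by
    obtain ⟨e₀, he₀⟩ := hG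
    obtain ⟨s, rfl⟩ : ∃ s, r = s + 1 := ⟨r - 1, by omega⟩
    obtain ⟨T', N, hN, hL, hle⟩ := PIR.exists_multigraph_scheme
      (ends := PIR.graphEnds G) (r := s + 1) (fun e => G.not_isDiag_of_mem_edgeSet e.2) T hbits
      hsrp ⟨e₀, he₀⟩
      (⟨e₀, he₀⟩, 0)
    refine ⟨T', _, T'.hasRate (⟨e₀, he₀⟩, 0), ?_⟩
    have h1 := T.sum_entropy_pos ⟨e₀, he₀⟩
    have h2 := T'.sum_entropy_pos (⟨e₀, he₀⟩, 0)
    rw [hR ⟨e₀, he₀⟩, Nat.add_sub_cancel]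
    rw [Nat.add_sub_cancel] at hL
    set H := ∑ v, Shannon.entropy (T.law ⟨e₀, he₀⟩) (T.ans v)
    have hs : (1 : ℝ) ≤ 2 ^ s := one_le_pow₀ one_le_two
    have hs1 : (0 : ℝ) < 2 ^ (s + 1) - 1 := by rw [pow_succ]; linarith
    have hN' : (0 : ℝ) < N := Nat.cast_pos.2 hN
    calc (T.L : ℝ) / H * (1 / (2 - 1 / 2 ^ s))
        = T'.L / ((2 ^ (s + 1) - 1) * (N * H)) := by
          have : (2 : ℝ) - 1 / 2 ^ s = (2 ^ (s + 1) - 1) / 2 ^ s := by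
            rw [pow_succ]
            field_simp
          rw [this, hL]
          push_cast
          field_simp
      _ ≤ _ := div_le_div_of_nonneg_left (Nat.cast_nonneg _) h2 hle
  refine ⟨main, ?_⟩
  obtain ⟨T', R', hT', hR'⟩ := main
  exact (EReal.coe_le_coe_iff.2 hR').trans (le_sSup ⟨T', R', hT', rfl⟩)
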